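/- **Setting.** Let $\mathbb T\subset\mathbb R$ be a time scale: a closed set with $0\in\mathbb T$ and $\sup\mathbb T=+\infty$. Put $\sigma(t)=\inf\{s\in\mathbb T: s>t\}$, $\mu(t)=\sigma(t)-t$ and $\mathbb T^+_a=\mathbb T\cap[a,\infty)$. A function on $\mathbb T$ is rd-continuous if it is continuous at every right-dense point ($\sigma(t)=t$) and has a finite left-sided limit at every left-dense point. The $\Delta$-derivative $f^\Delta(t)=\gamma$ means that for every $\varepsilon>0$ one has $|f(\sigma(t))-f(s)-\gamma(\sigma(t)-s)|\le\varepsilon|\sigma(t)-s|$ for all $s\in\mathbb T$ near $t$, and $\int_a^b f\,\Delta\tau=F(b)-F(a)$ where $F^\Delta=f$. The time scale is syndetic if $\limsup_{\mathbb T\ni t\to+\infty}\mu(t)<+\infty$. Let $\mathbb K\in\{\mathbb R,\mathbb C\}$, let $|\cdot|$ be the Euclidean norm on $\mathbb K^n$ and the induced operator norm, and let $\mathcal A:\mathbb T\to\mathbb K^{n\times n}$ be rd-continuous. $\mathcal A$ is uniformly regressive if all matrices $E_n+\mu(t)\mathcal A(t)$, $t\in\mathbb T$, are invertible and their inverses are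 bounded on $\mathbb T$. The fundamental matrix $\Phi_{\mathcal A}(t,s)$, $t\ge s$, is the solution of $\Phi^\Delta=\mathcal A(t)\Phi$ with $\Phi(s,s)=E_n$. For rd-continuous $u:\mathbb T^+_0\to\mathbb R$ with $1+\mu u>0$ let $$e_u(t,s)=\exp\int_s^t\xi_{\mu(\tau)}(u(\tau))\,\Delta\tau,\qquad \xi_h(z)=\frac{\log(1+hz)}{h}\ (h\ne0),\quad \xi_0(z)=z .$$ Such a $u$ is an upper function of the system $x^\Delta=\mathcal A(t)x$ if for some $C>0$ we have $|\Phi_{\mathcal A}(t,s)|\le C e_u(t,s)$ for all $t\ge s$ in $\mathbb T^+_0$. The central upper exponent is $$\chi(\mathcal A)=\inf_u\ \limsup_{\mathbb T\ni t\to+\infty}\frac1t\log e_u(t,0)=\inf_u\ \limsup_{\mathbb T\ni t\to+\infty}\frac1t\int_0^t\xi_{\mu(\tau)}(u(\tau))\,\Delta\tau\in[-\infty,+\infty],$$ the infimum being over all upper functions $u$. The system is stable if for all $t_0\in\mathbb T$ and $\varepsilon>0$ there is $\eta>0$ such that every solution $x$ on $\mathbb T^+_{t_0}$ with $|x(t_0)|<\eta$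 satisfies $|x(t)|<\varepsilon$ for all $t\in\mathbb T^+_{t_0}$; otherwise it is unstable. **Theorem 6.1.** Let $\mathbb T$ be a syndetic time scale, and let $\mathcal A:\mathbb T\to\mathbb K^{n\times n}$ be rd-continuous, bounded and uniformly regressive with $\chi(\mathcal A)\ge0$. Then for every $\delta>0$ there is an rd-continuous $\mathcal B_\delta:\mathbb T\to\mathbb K^{n\times n}$ with $\sup_{t\in\mathbb T}|\mathcal B_\delta(t)|\le\delta$ such that $\mathcal A+\mathcal B_\delta$ is uniformly regressive and the system $x^\Delta=(\mathcal A(t)+\mathcal B_\delta(t))x$ is unstable. -/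

import Mathlib

open Filter Topology
open scoped Matrix.Norms.L2Operator

/-! The norm on `Matrix (Fin n) (Fin n) 𝕜` is the operator norm induced by the Euclidean norm.
All notions on a time scale `T ⊆ ℝ` are formulated for functions on `ℝ` but involve only their
values at the points of `T`.  The half line `T ∩ [a, ∞)` of a time scale is `T ∩ Set.Ici a`. -/

namespace TimeScale

/-- A time scale: a closed subset of the line that contains `0` and is unbounded to the right. -/
structure IsTimeScale (T : Set ℝ) : Prop where
  isClosed : IsClosed T
  zero_mem : (0 : ℝ) ∈ T
  not_bddAbove : ¬ BddAbove T

/-- Forward jump operator `σ(t) = inf {s ∈ T : s > t}`. -/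
noncomputable def sigma (T : Set ℝ) (t : ℝ) : ℝ := sInf {s | s ∈ T ∧ t < s}

/-- Graininess `μ(t) = σ(t) - t`. -/
noncomputable def mu (T : Set ℝ) (t : ℝ) : ℝ := sigma T t - t

/-- The filter "`t → +∞`, `t ∈ T`". -/
def atTopIn (T : Set ℝ) : Filter ℝ := atTop ⊓ 𝓟 T

/-- `T` is syndetic: `limsup μ(t) < +∞` as `t → +∞` in `T`. -/
def IsSyndetic (T : Set ℝ) : Prop :=
  limsup (fun t => ((mu T t : ℝ) : EReal)) (atTopIn T) < ⊤

/-- rd-continuity on `T`: continuity at right-dense points, finite left-sided limits at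
left-dense points. -/
def RdContinuous {F : Type*} [TopologicalSpace F] (T : Set ℝ) (f : ℝ → F) : Prop :=
  ∀ t ∈ T, (sigma T t = t → ContinuousWithinAt f T t) ∧
    (t ∈ closure (T ∩ Set.Iio t) → ∃ l : F, Tendsto f (𝓝[T ∩ Set.Iio t] t) (𝓝 l))

/-- `f` is Δ-differentiable at `t` with `f^Δ(t) = γ`. -/
def HasDeltaDerivAt {F : Type*} [NormedAddCommGroup F] [Module ℝ F]
    (T : Set ℝ) (f : ℝ → F) (γ : F) (t : ℝ) : Prop :=
  ∀ ε : ℝ, 0 < ε → ∀ᶠ s in 𝓝[T] t,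
    ‖(f (sigma T t) - f s) - (sigma T t - s) • γ‖ ≤ ε * |sigma T t - s|

/-- `G` is a Δ-antiderivative of `f` on `T`. -/
def IsDeltaAntideriv (T : Set ℝ) (f G : ℝ → ℝ) : Prop :=
  ∀ t ∈ T, HasDeltaDerivAt T G (f t) t

open Classical in
/-- Cauchy Δ-integral `∫_a^b f(τ) Δτ = G(b) - G(a)`, where `G` is a Δ-antiderivative of `f` on `T`
(the value `0` is used only if there is none). -/
noncomputable def deltaIntegral (T : Set ℝ) (f : ℝ → ℝ) (a b : ℝ) : ℝ :=
  if h : ∃ G : ℝ → ℝ, IsDeltaAntideriv T f G then h.choose b - h.choose a else 0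

/-- Cylinder transformation `ξ_h(z)`; it is used only where `1 + z h > 0`. -/
noncomputable def cylinder (h z : ℝ) : ℝ := if h = 0 then z else Real.log (1 + z * h) / h

/-- `∫_s^t ξ_{μ(τ)}(u(τ)) Δτ`, the logarithm of the generalized exponential `e_u(t,s)`. -/
noncomputable def logGenExp (T : Set ℝ) (u : ℝ → ℝ) (t s : ℝ) : ℝ :=
  deltaIntegral T (fun τ => cylinder (mu T τ) (u τ)) s t

/-- Generalized exponential function `e_u(t,s)`. -/
noncomputable def genExp (T : Set ℝ) (u : ℝ → ℝ) (t s : ℝ) : ℝ := Real.exp (logGenExp T u t s)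

section Linear

variable {𝕜 : Type*} [RCLike 𝕜] {n : ℕ}

/-- `A` is bounded on `T`. -/
def IsBounded (T : Set ℝ) (A : ℝ → Matrix (Fin n) (Fin n) 𝕜) : Prop :=
  ∃ K : ℝ, ∀ t ∈ T, ‖A t‖ ≤ K

/-- `A` is uniformly regressive on `T`: the matrices `E + μ(t) A(t)` are invertible, with
inverses bounded on `T`. -/
def IsUniformlyRegressive (T : Set ℝ) (A : ℝ → Matrix (Fin n) (Fin n) 𝕜) : Prop :=
  (∀ t ∈ T, IsUnit (1 + mu T t • A t)) ∧ ∃ K : ℝ, ∀ t ∈ T, ‖(1 + mu T t • A t)⁻¹‖ ≤ K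

/-- `Φ t s`, for `s ≤ t` in `T`, is the fundamental matrix of `x^Δ = A(t) x`. -/
def IsFundamentalMatrix (T : Set ℝ) (A : ℝ → Matrix (Fin n) (Fin n) 𝕜)
    (Φ : ℝ → ℝ → Matrix (Fin n) (Fin n) 𝕜) : Prop :=
  ∀ s ∈ T, Φ s s = 1 ∧
    ∀ t ∈ T, s ≤ t → HasDeltaDerivAt (T ∩ Set.Ici s) (fun r => Φ r s) (A t * Φ t s) t

/-- `u` is an upper function on `T⁺ = T ∩ [0,∞)`: it is rd-continuous and
`|Φ(t,s)| ≤ C e_u(t,s)` for `t ≥ s` in `T⁺`.  Positivity of `1 + μ u` says that `e_u` is defined and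
positive, which the inequality requires. -/
def IsUpperFunction (T : Set ℝ) (A : ℝ → Matrix (Fin n) (Fin n) 𝕜) (u : ℝ → ℝ) : Prop :=
  RdContinuous (T ∩ Set.Ici 0) u ∧
  (∀ t ∈ T ∩ Set.Ici 0, 0 < 1 + mu T t * u t) ∧
  ∃ Φ : ℝ → ℝ → Matrix (Fin n) (Fin n) 𝕜, IsFundamentalMatrix (T ∩ Set.Ici 0) A Φ ∧
    ∃ C : ℝ, 0 < C ∧ ∀ s ∈ T ∩ Set.Ici 0, ∀ t ∈ T ∩ Set.Ici 0, s ≤ t →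
      ‖Φ t s‖ ≤ C * genExp (T ∩ Set.Ici 0) u t s

/-- Central upper exponent
`χ(A) = inf_u limsup_{t → ∞} (1/t) log e_u(t,0) = inf_u limsup_{t → ∞} (1/t) ∫_0^t ξ_{μ}(u) Δτ`,
the infimum over all upper functions `u`, as an extended real number. -/
noncomputable def centralUpperExponent (T : Set ℝ) (A : ℝ → Matrix (Fin n) (Fin n) 𝕜) : EReal :=
  ⨅ (u : ℝ → ℝ) (_ : IsUpperFunction T A u),
    limsup (fun t => ((1 / t * logGenExp (T ∩ Set.Ici 0) u t 0 : ℝ) : EReal)) (atTopIn T)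

/-- `x` solves `x^Δ = A(t) x` on `T ∩ [t₀, ∞)`. -/
def IsSolutionFrom (T : Set ℝ) (A : ℝ → Matrix (Fin n) (Fin n) 𝕜) (t₀ : ℝ)
    (x : ℝ → EuclideanSpace 𝕜 (Fin n)) : Prop :=
  ∀ t ∈ T ∩ Set.Ici t₀, HasDeltaDerivAt (T ∩ Set.Ici t₀) x (Matrix.toEuclideanLin (A t) (x t)) t

/-- The system `x^Δ = A(t) x` is stable. -/
def IsStable (T : Set ℝ) (A : ℝ → Matrix (Fin n) (Fin n) 𝕜) : Prop :=
  ∀ t₀ ∈ T, ∀ ε : ℝ, 0 < ε → ∃ δ : ℝ, 0 < δ ∧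
    ∀ x : ℝ → EuclideanSpace 𝕜 (Fin n), IsSolutionFrom T A t₀ x → ‖x t₀‖ < δ →
      ∀ t ∈ T ∩ Set.Ici t₀, ‖x t‖ < ε

end Linear

end TimeScale

namespace TimeScale

/-! ### Forward jump and graininess -/

section Basic

variable {T : Set ℝ} {t s a : ℝ}

/-! Everything happens on `T ∩ [0, ∞)`, where syndeticity bounds `μ` by some `M`. Let `X` be a
fundamental solution with inverse `Y`. Cut the half line into blocks of length `L`, take the first
point of `T` in or after each block start as a node, and let `a_N` be the logarithm of the norm of
the transition matrix from node `N` to node `N + 1`.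

By submultiplicativity, `‖X t * Y s‖ ≤ C exp (G t - G s)` for any function `G` that stays within
bounded distance of the partial sums of `a` (`norm_le_exp_stepSum`). Choosing `G` to be a `C¹`
staircase makes `exp G` the generalized exponential of an rd-continuous `u`, whatever `T` looks
like, so `u` is an upper function. Nonnegativity of the central exponent then says that `a_0 + ... +
a_{N-1}` exceeds `-κ N L - const` for arbitrarily large `N`, for each `κ > 0`.

This growth of norms is turned into growth of a single solution by Millionshchikov-type rotations:
at every node the solution is displaced by a relative amount `ε`, after which the next transition
matrix stretches it by at least `ε / 2` times its full norm (`exists_kick`). The cost is `log (2 /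
ε)` per block, hence an exponential rate `log (2 / ε) / L`, which is small once `L` is large. A
factor `e^{η t}` with small `η` beats both this loss and `κ`, and the resulting path is unbounded.

Each displacement is spread smoothly over a unit interval lying within `M + 1` of its node. The path
therefore solves `x^Δ = A x + g` with `‖g‖ ≤ δ ‖x‖`, where the constants do not involve `L`
(`norm_dslope_stepPath_le`); this is what allows `ε` and `η` to be fixed before `L`. The rank one
matrix `g x^* / ‖x‖²` is a perturbation of norm at most `δ` for which `x` is a solution. A ramp near
`0` extends it to all of `T`, and a Neumann series argument gives uniform regressivity. -/

theorem IsTimeScale.nonempty_gt (hT : IsTimeScale T) (t : ℝ) : {s | s ∈ T ∧ t < s}.Nonempty := by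
  obtain ⟨s, hs, hts⟩ := not_bddAbove_iff.1 hT.not_bddAbove t
  exact ⟨s, hs, hts⟩

theorem bddBelow_gt (T : Set ℝ) (t : ℝ) : BddBelow {s | s ∈ T ∧ t < s} :=
  ⟨t, fun _ hs => hs.2.le⟩

theorem IsTimeScale.le_sigma (hT : IsTimeScale T) (t : ℝ) : t ≤ sigma T t :=
  le_csInf (hT.nonempty_gt t) fun _ hs => hs.2.le

theorem IsTimeScale.sigma_mem (hT : IsTimeScale T) (t : ℝ) : sigma T t ∈ T := by
  have h := csInf_mem_closure (hT.nonempty_gt t) (bddBelow_gt T t)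
  exact hT.isClosed.closure_subset_iff.2 (fun _ hs => hs.1) h

theorem sigma_le (hs : s ∈ T) (hts : t < s) : sigma T t ≤ s :=
  csInf_le (bddBelow_gt T t) ⟨hs, hts⟩

theorem IsTimeScale.mu_nonneg (hT : IsTimeScale T) (t : ℝ) : 0 ≤ mu T t :=
  sub_nonneg.2 (hT.le_sigma t)

theorem sigma_eq (T : Set ℝ) (t : ℝ) : sigma T t = t + mu T t := by
  simp [mu]

theorem sigma_inter_Ici (T : Set ℝ) (hat : a ≤ t) : sigma (T ∩ Set.Ici a) t = sigma T t := by
  unfold sigma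
  congr 1
  ext s
  simp only [Set.mem_inter_iff, Set.mem_Ici, Set.mem_ofPred_eq]
  exact ⟨fun h => ⟨h.1.1, h.2⟩, fun h => ⟨⟨h.1, hat.trans h.2.le⟩, h.2⟩⟩

theorem mu_inter_Ici (T : Set ℝ) (hat : a ≤ t) : mu (T ∩ Set.Ici a) t = mu T t := by
  simp [mu, sigma_inter_Ici T hat]

theorem IsTimeScale.inter_Ici_zero (hT : IsTimeScale T) : IsTimeScale (T ∩ Set.Ici 0) where
  isClosed := hT.isClosed.inter isClosed_Ici
  zero_mem := ⟨hT.zero_mem, Set.self_mem_Ici⟩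
  not_bddAbove := by
    rw [not_bddAbove_iff]
    intro x
    obtain ⟨s, hs, hxs⟩ := hT.nonempty_gt (max x 0)
    exact ⟨s, ⟨hs, (le_max_right _ _).trans hxs.le⟩, (le_max_left _ _).trans_lt hxs⟩

theorem IsTimeScale.tendsto_sigma_of_rightDense (hT : IsTimeScale T) (h : sigma T t = t) :
    Tendsto (sigma T) (𝓝[T] t) (𝓝 t) := by
  rw [tendsto_order]
  constructor
  · intro b hb
    filter_upwards [nhdsWithin_le_nhds (lt_mem_nhds hb)] with s hs
    exact hs.trans_le (hT.le_sigma s)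
  · intro b hb
    have : sigma T t < b := by rwa [h]
    obtain ⟨r, ⟨hr, htr⟩, hrb⟩ := exists_lt_of_csInf_lt (hT.nonempty_gt t) this
    filter_upwards [nhdsWithin_le_nhds (gt_mem_nhds htr)] with s hs
    exact (sigma_le hr hs).trans_lt hrb

/-- Squeeze `s ≤ σ(s) ≤ t` for `s < t`. The limit is `t` even if `t` is right-scattered, so `σ` and
`μ` may jump there, which rd-continuity permits. -/
theorem IsTimeScale.tendsto_sigma_of_leftDense (hT : IsTimeScale T) (ht : t ∈ T) :
    Tendsto (sigma T) (𝓝[T ∩ Set.Iio t] t) (𝓝 t) := by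
  refine tendsto_of_tendsto_of_tendsto_of_le_of_le' (g := id) (h := fun _ => t)
    nhdsWithin_le_nhds tendsto_const_nhds ?_ ?_
  · exact Eventually.of_forall fun s => hT.le_sigma s
  · filter_upwards [self_mem_nhdsWithin] with s hs
    exact sigma_le ht hs.2

end Basic

/-! ### Stability properties of rd-continuity -/

section RdContinuity

variable {T : Set ℝ} {E F G : Type*} [TopologicalSpace E] [TopologicalSpace F] [TopologicalSpace G]

theorem RdContinuous.of_continuousOn {f : ℝ → E} (hf : ContinuousOn f T) : RdContinuous T f :=
  fun t ht => ⟨fun _ => hf t ht, fun _ => ⟨f t, (hf t ht).mono Set.inter_subset_left⟩⟩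

theorem RdContinuous.comp₂ {φ : E → F → G} (hφ : Continuous fun p : E × F => φ p.1 p.2)
    {f : ℝ → E} {g : ℝ → F} (hf : RdContinuous T f) (hg : RdContinuous T g) :
    RdContinuous T fun t => φ (f t) (g t) := by
  intro t ht
  refine ⟨fun h => ?_, fun h => ?_⟩
  · exact hφ.continuousAt.tendsto.comp (((hf t ht).1 h).prodMk_nhds ((hg t ht).1 h))
  · obtain ⟨l, hl⟩ := (hf t ht).2 h
    obtain ⟨m, hm⟩ := (hg t ht).2 h
    exact ⟨φ l m, (hφ.tendsto (l, m)).comp (hl.prodMk_nhds hm)⟩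

theorem RdContinuous.comp {φ : E → G} (hφ : Continuous φ) {f : ℝ → E} (hf : RdContinuous T f) :
    RdContinuous T fun t => φ (f t) :=
  RdContinuous.comp₂ (φ := fun x _ => φ x) (hφ.comp continuous_fst) hf hf

theorem RdContinuous.inter_Ici {f : ℝ → E} (hf : RdContinuous T f) (a : ℝ) :
    RdContinuous (T ∩ Set.Ici a) f := by
  intro t ht
  refine ⟨fun h => ((hf t ht.1).1 ?_).mono Set.inter_subset_left, fun h => ?_⟩
  · rwa [sigma_inter_Ici T ht.2] at h
  · have hsub : (T ∩ Set.Ici a) ∩ Set.Iio t ⊆ T ∩ Set.Iio t :=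
      Set.inter_subset_inter_left _ Set.inter_subset_left
    obtain ⟨l, hl⟩ := (hf t ht.1).2 (closure_mono hsub h)
    exact ⟨l, hl.mono_left (nhdsWithin_mono _ hsub)⟩

theorem IsTimeScale.rdContinuous_mu (hT : IsTimeScale T) : RdContinuous T (mu T) := by
  intro t ht
  refine ⟨fun h => ?_, fun h => ⟨0, ?_⟩⟩
  · have := (hT.tendsto_sigma_of_rightDense h).sub (tendsto_id.mono_left nhdsWithin_le_nhds)
    have h0 : mu T t = t - t := by rw [mu, h]
    unfold ContinuousWithinAt
    rw [h0]
    exact this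
  · have := (hT.tendsto_sigma_of_leftDense ht).sub (tendsto_id.mono_left nhdsWithin_le_nhds)
    rw [sub_self] at this
    exact this

end RdContinuity

/-! ### Calculus of the Δ-derivative -/

section Derivative

variable {T : Set ℝ} {E F G : Type*} [NormedAddCommGroup E] [NormedSpace ℝ E]
  [NormedAddCommGroup F] [NormedSpace ℝ F] [NormedAddCommGroup G] [NormedSpace ℝ G] {t : ℝ}

theorem hasDeltaDerivAt_iff_of_rightDense {f : ℝ → E} {γ : E} (h : sigma T t = t) :
    HasDeltaDerivAt T f γ t ↔ HasDerivWithinAt f γ T t := by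
  rw [hasDerivWithinAt_iff_isLittleO, Asymptotics.isLittleO_iff]
  unfold HasDeltaDerivAt
  refine forall_congr' fun ε => forall_congr' fun _ => ?_
  refine eventually_congr (Eventually.of_forall fun s => ?_)
  rw [h, Real.norm_eq_abs, abs_sub_comm s t, ← norm_neg (f s - f t - _)]
  have : -(f s - f t - (s - t) • γ) = f t - f s - (t - s) • γ := by module
  rw [this]

/-- Putting `s = t` in the defining inequality and letting `ε → 0` forces the difference quotient.
Letting `s → t`, with `σ(t) - s` staying close to `μ(t) > 0`, forces continuity. -/
theorem hasDeltaDerivAt_iff_of_rightScattered {f : ℝ → E} {γ : E} (ht : t ∈ T)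
    (h : t < sigma T t) :
    HasDeltaDerivAt T f γ t ↔
      ContinuousWithinAt f T t ∧ f (sigma T t) = f t + mu T t • γ := by
  have hμ : 0 < mu T t := sub_pos.2 h
  constructor
  · intro hf
    have hval : f (sigma T t) = f t + mu T t • γ := by
      have key : ‖f (sigma T t) - f t - mu T t • γ‖ ≤ 0 := by
        refine le_of_forall_pos_le_add fun ε hε => ?_
        have := (hf (ε / mu T t) (by positivity)).self_of_nhdsWithin ht
        rw [← mu, abs_of_pos hμ, div_mul_cancel₀ _ hμ.ne'] at this
        simpa using this
      have := norm_le_zero_iff.1 key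
      rw [sub_sub, sub_eq_zero] at this
      exact this
    refine ⟨?_, hval⟩
    have hlim : Tendsto (fun s => f (sigma T t) - f s - (sigma T t - s) • γ) (𝓝[T] t) (𝓝 0) := by
      rw [Metric.tendsto_nhds]
      intro ε hε
      have hc : Tendsto (fun s => (ε / (2 * mu T t)) * |sigma T t - s|) (𝓝[T] t)
          (𝓝 ((ε / (2 * mu T t)) * |sigma T t - t|)) := by
        apply Tendsto.mono_left _ nhdsWithin_le_nhds
        exact Continuous.tendsto (by fun_prop) t
      have hlt : (ε / (2 * mu T t)) * |sigma T t - t| < ε := by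
        rw [← mu, abs_of_pos hμ]
        field_simp
        linarith
      filter_upwards [hf (ε / (2 * mu T t)) (by positivity), hc.eventually (gt_mem_nhds hlt)]
        with s h1 h2
      rw [dist_zero_right]
      exact h1.trans_lt h2
    have h2 : Tendsto (fun s => f (sigma T t) - (sigma T t - s) • γ) (𝓝[T] t)
        (𝓝 (f (sigma T t) - (sigma T t - t) • γ)) := by
      apply Tendsto.mono_left _ nhdsWithin_le_nhds
      exact Continuous.tendsto (by fun_prop) t
    have h3 := h2.sub hlim
    unfold ContinuousWithinAt
    have e : f (sigma T t) - (sigma T t - t) • γ - 0 = f t := by rw [hval, mu]; simp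
    rw [e] at h3
    refine h3.congr fun s => ?_
    abel
  · rintro ⟨hc, hval⟩ ε hε
    have hlim : Tendsto (fun s => ‖f (sigma T t) - f s - (sigma T t - s) • γ‖
        - ε * |sigma T t - s|) (𝓝[T] t)
        (𝓝 (‖f (sigma T t) - f t - (sigma T t - t) • γ‖ - ε * |sigma T t - t|)) := by
      refine ((Tendsto.sub (tendsto_const_nhds.sub hc) ?_).norm).sub ?_ <;>
      · apply Tendsto.mono_left _ nhdsWithin_le_nhds
        exact Continuous.tendsto (by fun_prop) t
    have hlt : ‖f (sigma T t) - f t - (sigma T t - t) • γ‖ - ε * |sigma T t - t| < 0 := by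
      rw [hval, ← mu, abs_of_pos hμ]
      simp only [add_sub_cancel_left, sub_self, norm_zero, zero_sub, Left.neg_neg_iff]
      positivity
    filter_upwards [hlim.eventually (gt_mem_nhds hlt)] with s hs
    linarith

theorem HasDeltaDerivAt.continuousWithinAt {f : ℝ → E} {γ : E} (hT : IsTimeScale T) (ht : t ∈ T)
    (hf : HasDeltaDerivAt T f γ t) : ContinuousWithinAt f T t := by
  rcases (hT.le_sigma t).eq_or_lt with h | h
  · exact ((hasDeltaDerivAt_iff_of_rightDense h.symm).1 hf).continuousWithinAt
  · exact ((hasDeltaDerivAt_iff_of_rightScattered ht h).1 hf).1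

theorem HasDeltaDerivAt.apply_sigma {f : ℝ → E} {γ : E} (hT : IsTimeScale T) (ht : t ∈ T)
    (hf : HasDeltaDerivAt T f γ t) : f (sigma T t) = f t + mu T t • γ := by
  rcases (hT.le_sigma t).eq_or_lt with h | h
  · simp [mu, ← h]
  · exact ((hasDeltaDerivAt_iff_of_rightScattered ht h).1 hf).2

theorem HasDeltaDerivAt.congr_deriv {f : ℝ → E} {γ γ' : E} (hf : HasDeltaDerivAt T f γ t)
    (h : γ = γ') : HasDeltaDerivAt T f γ' t := h ▸ hf

theorem HasDeltaDerivAt.inter_Ici {f : ℝ → E} {γ : E} (hf : HasDeltaDerivAt T f γ t) {a : ℝ}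
    (ha : a ≤ t) : HasDeltaDerivAt (T ∩ Set.Ici a) f γ t := by
  intro ε hε
  rw [sigma_inter_Ici T ha]
  exact (hf ε hε).filter_mono (nhdsWithin_mono _ Set.inter_subset_left)

/-- Leibniz rule for the Δ-derivative. -/
theorem HasDeltaDerivAt.bilinear (B : E →L[ℝ] F →L[ℝ] G) {f : ℝ → E} {g : ℝ → F} {f' : E} {g' : F}
    (hT : IsTimeScale T) (ht : t ∈ T)
    (hf : HasDeltaDerivAt T f f' t) (hg : HasDeltaDerivAt T g g' t) :
    HasDeltaDerivAt T (fun s => B (f s) (g s)) (B (f (sigma T t)) g' + B f' (g t)) t := by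
  rcases (hT.le_sigma t).eq_or_lt with h | h
  · rw [hasDeltaDerivAt_iff_of_rightDense h.symm] at *
    rw [← h]
    exact B.hasDerivWithinAt_of_bilinear hf hg
  · have hc1 := hf.continuousWithinAt hT ht
    have hc2 := hg.continuousWithinAt hT ht
    rw [hasDeltaDerivAt_iff_of_rightScattered ht h]
    refine ⟨?_, ?_⟩
    · exact B.continuous₂.continuousAt.tendsto.comp (hc1.prodMk_nhds hc2)
    · rw [hf.apply_sigma hT ht, hg.apply_sigma hT ht]
      simp only [map_add, map_smul, smul_add, add_apply,
        smul_apply]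
      abel

theorem HasDeltaDerivAt.clm_apply (L : E →L[ℝ] F) {f : ℝ → E} {f' : E}
    (hT : IsTimeScale T) (ht : t ∈ T)
    (hf : HasDeltaDerivAt T f f' t) : HasDeltaDerivAt T (fun s => L (f s)) (L f') t := by
  rcases (hT.le_sigma t).eq_or_lt with h | h
  · rw [hasDeltaDerivAt_iff_of_rightDense h.symm] at *
    exact L.hasFDerivAt.comp_hasDerivWithinAt t hf
  · rw [hasDeltaDerivAt_iff_of_rightScattered ht h] at *
    refine ⟨L.continuous.continuousAt.comp_continuousWithinAt hf.1, ?_⟩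
    rw [hf.2, map_add, map_smul]

theorem HasDeltaDerivAt.sub {f g : ℝ → E} {f' g' : E} (hT : IsTimeScale T) (ht : t ∈ T)
    (hf : HasDeltaDerivAt T f f' t) (hg : HasDeltaDerivAt T g g' t) :
    HasDeltaDerivAt T (fun s => f s - g s) (f' - g') t := by
  rcases (hT.le_sigma t).eq_or_lt with h | h
  · rw [hasDeltaDerivAt_iff_of_rightDense h.symm] at *
    exact hf.sub hg
  · rw [hasDeltaDerivAt_iff_of_rightScattered ht h] at *
    refine ⟨hf.1.sub hg.1, ?_⟩
    rw [hf.2, hg.2]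
    module

theorem hasDeltaDerivAt_const (c : E) (t : ℝ) : HasDeltaDerivAt T (fun _ => c) 0 t := by
  intro ε hε
  refine Eventually.of_forall fun s => ?_
  simp only [sub_self, smul_zero, norm_zero]
  positivity

/-- A `C¹` function on the line is Δ-differentiable along every time scale. -/
theorem hasDeltaDerivAt_of_contDiff {f : ℝ → E} (hf : ContDiff ℝ 1 f) (hT : IsTimeScale T)
    (ht : t ∈ T) : HasDeltaDerivAt T f (dslope f t (sigma T t)) t := by
  rcases (hT.le_sigma t).eq_or_lt with h | h
  · rw [hasDeltaDerivAt_iff_of_rightDense h.symm, ← h, dslope_same]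
    exact (hf.differentiable (by simp) t).hasDerivAt.hasDerivWithinAt
  · rw [hasDeltaDerivAt_iff_of_rightScattered ht h]
    refine ⟨hf.continuous.continuousWithinAt, ?_⟩
    rw [mu, sub_smul_dslope]
    abel

/-- A `C¹` function is strictly differentiable, so both endpoints of the difference quotient may
move. This is needed because `t` and `σ(t)` approach the limit point together. -/
theorem tendsto_dslope_of_contDiff {f : ℝ → E} (hf : ContDiff ℝ 1 f) {α : Type*} {l : Filter α}
    {u v : α → ℝ} {c : ℝ} (hu : Tendsto u l (𝓝 c)) (hv : Tendsto v l (𝓝 c)) :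
    Tendsto (fun i => dslope f (u i) (v i)) l (𝓝 (deriv f c)) := by
  have hs : HasStrictDerivAt f (deriv f c) c := hf.contDiffAt.hasStrictDerivAt (by simp)
  have ho := (hs.isLittleO.comp_tendsto (hv.prodMk_nhds hu))
  have hd : Tendsto (fun i => deriv f (u i)) l (𝓝 (deriv f c)) :=
    (hf.continuous_deriv le_rfl).continuousAt.tendsto.comp hu
  rw [Metric.tendsto_nhds] at hd ⊢
  intro ε hε
  filter_upwards [hd ε hε, ho.def (half_pos hε)] with i h1 h2
  by_cases h : v i = u i
  · rw [h, dslope_same]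
    exact h1
  · rw [dslope_of_ne _ h, dist_eq_norm]
    have hne : v i - u i ≠ 0 := sub_ne_zero.2 h
    have hpos : 0 < ‖v i - u i‖ := norm_pos_iff.2 hne
    have e : slope f (u i) (v i) - deriv f c
        = (v i - u i)⁻¹ • (f (v i) - f (u i) - (v i - u i) • deriv f c) := by
      rw [slope_def_module, smul_sub (v i - u i)⁻¹ (_ - _), smul_smul, inv_mul_cancel₀ hne, one_smul]
    rw [e, norm_smul, norm_inv]
    have h3 : ‖f (v i) - f (u i) - (v i - u i) • deriv f c‖ ≤ ε / 2 * ‖v i - u i‖ := by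
      simpa using h2
    calc _ ≤ ‖v i - u i‖⁻¹ * (ε / 2 * ‖v i - u i‖) := by gcongr
      _ = ε / 2 := by field_simp
      _ < ε := half_lt_self hε

theorem rdContinuous_dslope_sigma {f : ℝ → E} (hf : ContDiff ℝ 1 f) (hT : IsTimeScale T) :
    RdContinuous T fun t => dslope f t (sigma T t) := by
  intro t ht
  refine ⟨fun h => ?_, fun _ => ⟨deriv f t, ?_⟩⟩
  · have := tendsto_dslope_of_contDiff hf (tendsto_id.mono_left nhdsWithin_le_nhds)
      (hT.tendsto_sigma_of_rightDense h)
    have e : dslope f t (sigma T t) = deriv f t := by rw [h, dslope_same]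
    unfold ContinuousWithinAt
    simpa only [e, id] using this
  · exact tendsto_dslope_of_contDiff hf (tendsto_id.mono_left nhdsWithin_le_nhds)
      (hT.tendsto_sigma_of_leftDense ht)

end Derivative

/-! ### Induction along a time scale and Grönwall's inequality -/

section Gronwall

variable {T : Set ℝ} {E : Type*} [NormedAddCommGroup E] [NormedSpace ℝ E]

/-- Induction principle on a time scale. -/
theorem IsTimeScale.induction_Ici (hT : IsTimeScale T) {a : ℝ} {p : ℝ → Prop} (ha : p a)
    (hscat : ∀ t ∈ T, a ≤ t → t < sigma T t → p t → p (sigma T t))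
    (hdense : ∀ t ∈ T, a ≤ t → sigma T t = t → p t → ∀ᶠ s in 𝓝[T ∩ Set.Ioi t] t, p s)
    (hleft : ∀ t ∈ T, a < t → t ∈ closure (T ∩ Set.Iio t) →
      (∀ s ∈ T, a ≤ s → s < t → p s) → p t) (haT : a ∈ T) :
    ∀ t ∈ T, a ≤ t → p t := by
  by_contra! hcon
  set S : Set ℝ := {t | t ∈ T ∧ a ≤ t ∧ ¬ p t} with hS
  have hSne : S.Nonempty := by
    obtain ⟨t, h1, h2, h3⟩ := hcon
    exact ⟨t, h1, h2, h3⟩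
  have hSb : BddBelow S := ⟨a, fun t ht => ht.2.1⟩
  set m := sInf S with hm
  have hmT : m ∈ T := hT.isClosed.closure_subset_iff.2 (fun t ht => ht.1)
    (csInf_mem_closure hSne hSb)
  have ham : a ≤ m := le_csInf hSne fun t ht => ht.2.1
  have hbelow : ∀ s ∈ T, a ≤ s → s < m → p s := by
    intro s hs has hsm
    by_contra hps
    exact absurd (csInf_le hSb ⟨hs, has, hps⟩) (not_le.2 hsm)
  have hpm : p m := by
    rcases ham.eq_or_lt with h | h
    · rwa [← h]
    by_cases hd : m ∈ closure (T ∩ Set.Iio m)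
    · exact hleft m hmT h hd hbelow
    -- If `m` is left-scattered, it is the forward jump of its predecessor `r`, so the scattered
    -- step applies at `r`.
    · have hne : (T ∩ Set.Iio m).Nonempty := ⟨a, haT, h⟩
      have hbd : BddAbove (T ∩ Set.Iio m) := ⟨m, fun s hs => hs.2.le⟩
      set r := sSup (T ∩ Set.Iio m) with hr
      have hrc := csSup_mem_closure hne hbd
      have hrm : r ≤ m := csSup_le hne fun s hs => hs.2.le
      have hrlt : r < m := lt_of_le_of_ne hrm fun e => hd (by rw [← hr, e] at hrc; exact hrc)
      have hrT : r ∈ T := hT.isClosed.closure_subset_iff.2 Set.inter_subset_left hrc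
      have har : a ≤ r := le_csSup hbd ⟨haT, h⟩
      have hsig : sigma T r = m := by
        apply le_antisymm (sigma_le hmT hrlt)
        refine le_csInf (hT.nonempty_gt r) fun s hs => ?_
        by_contra hlt
        exact absurd (le_csSup hbd ⟨hs.1, not_le.1 hlt⟩) (not_le.2 hs.2)
      rw [← hsig]
      exact hscat r hrT har (by rwa [hsig]) (hbelow r hrT har hrlt)
  rcases (hT.le_sigma m).eq_or_lt with h | h
  · have hev := hdense m hmT ham h.symm hpm
    rw [eventually_nhdsWithin_iff, Metric.eventually_nhds_iff] at hev
    obtain ⟨ε, hε, hev⟩ := hev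
    obtain ⟨s, hs, hsε⟩ := exists_lt_of_csInf_lt hSne (show sInf S < m + ε by linarith)
    have hms : m ≤ s := csInf_le hSb hs
    have hne : m ≠ s := fun e => hs.2.2 (e ▸ hpm)
    have hlt : m < s := lt_of_le_of_ne hms hne
    refine hs.2.2 (hev ?_ ⟨hs.1, hlt⟩)
    rw [Real.dist_eq, abs_of_pos (by linarith)]
    linarith
  · obtain ⟨s, hs, hsε⟩ := exists_lt_of_csInf_lt hSne (show sInf S < sigma T m from h)
    have hms : m ≤ s := csInf_le hSb hs
    have hlt : m < s := lt_of_le_of_ne hms fun e => hs.2.2 (e ▸ hpm)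
    exact absurd (sigma_le hs.1 hlt) (not_le.2 hsε)

/-- Grönwall's inequality on a time scale. -/
theorem IsTimeScale.norm_le_exp_mul (hT : IsTimeScale T) {a K : ℝ} (haT : a ∈ T) (hK : 0 ≤ K)
    {x x' : ℝ → E} (hx : ∀ t ∈ T, a ≤ t → HasDeltaDerivAt T x (x' t) t)
    (hx' : ∀ t ∈ T, a ≤ t → ‖x' t‖ ≤ K * ‖x t‖) :
    ∀ t ∈ T, a ≤ t → ‖x t‖ ≤ Real.exp (K * (t - a)) * ‖x a‖ := by
  -- The extra `ε` in the rate absorbs the error of the linear approximation at right-dense points;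
  -- the `ε` in the initial value keeps the bound `b` positive, so that `ε * b` is an admissible
  -- tolerance.
  have key : ∀ ε > 0, ∀ t ∈ T, a ≤ t →
      ‖x t‖ ≤ Real.exp ((K + ε) * (t - a)) * (‖x a‖ + ε) := by
    intro ε hε
    have hC : 0 < ‖x a‖ + ε := by positivity
    refine hT.induction_Ici (p := fun t => ‖x t‖ ≤ Real.exp ((K + ε) * (t - a)) * (‖x a‖ + ε))
      ?_ ?_ ?_ ?_ haT
    · simp [hε.le]
    · intro t ht hat hσ hp
      have hμ := hT.mu_nonneg t
      rw [(hx t ht hat).apply_sigma hT ht]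
      have h1 : ‖x t + mu T t • x' t‖ ≤ (1 + (K + ε) * mu T t) * ‖x t‖ := by
        calc _ ≤ ‖x t‖ + ‖mu T t • x' t‖ := norm_add_le _ _
          _ ≤ ‖x t‖ + mu T t * (K * ‖x t‖) := by
            rw [norm_smul, Real.norm_of_nonneg hμ]
            gcongr
            exact hx' t ht hat
          _ ≤ _ := by nlinarith [mul_nonneg (mul_nonneg hε.le hμ) (norm_nonneg (x t))]
      have h2 : 1 + (K + ε) * mu T t ≤ Real.exp ((K + ε) * mu T t) := by
        linarith [Real.add_one_le_exp ((K + ε) * mu T t)]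
      calc _ ≤ _ := h1
        _ ≤ Real.exp ((K + ε) * mu T t) * (Real.exp ((K + ε) * (t - a)) * (‖x a‖ + ε)) := by
          gcongr
        _ = _ := by
          rw [← mul_assoc, ← Real.exp_add, mu]
          congr 2
          ring
    · intro t ht hat hσ hp
      have hb : 0 < Real.exp ((K + ε) * (t - a)) * (‖x a‖ + ε) := by positivity
      set b := Real.exp ((K + ε) * (t - a)) * (‖x a‖ + ε) with hbdef
      have hd := hx t ht hat (ε * b) (by positivity)
      have hd' := hd.filter_mono (nhdsWithin_mono t (Set.inter_subset_left (t := Set.Ioi t)))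
      filter_upwards [hd', self_mem_nhdsWithin] with s hs hsm
      have hts : t < s := hsm.2
      rw [hσ, abs_sub_comm, abs_of_pos (sub_pos.2 hts)] at hs
      have e : x s = x t + (s - t) • x' t - (x t - x s - (t - s) • x' t) := by module
      have h1 : ‖x s‖ ≤ b * (1 + (K + ε) * (s - t)) := by
        have hn : ‖x s‖ ≤ ‖x t‖ + (s - t) * (K * ‖x t‖) + ε * b * (s - t) := by
          rw [e]
          refine (norm_sub_le _ _).trans (add_le_add ((norm_add_le _ _).trans ?_) hs)
          rw [norm_smul, Real.norm_of_nonneg (sub_pos.2 hts).le]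
          gcongr
          exact hx' t ht hat
        have h3 : (s - t) * (K * ‖x t‖) ≤ (s - t) * (K * b) := by
          have := (sub_pos.2 hts).le
          gcongr
        linarith
      have h2 : 1 + (K + ε) * (s - t) ≤ Real.exp ((K + ε) * (s - t)) := by
        linarith [Real.add_one_le_exp ((K + ε) * (s - t))]
      calc _ ≤ _ := h1
        _ ≤ b * Real.exp ((K + ε) * (s - t)) := by gcongr
        _ = _ := by
          rw [hbdef, mul_right_comm, ← Real.exp_add]
          congr 2
          ring
    · intro t ht hat hd hp
      have : (𝓝[T ∩ Set.Iio t] t).NeBot := mem_closure_iff_nhdsWithin_neBot.1 hd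
      have hc : Tendsto (fun s => ‖x s‖) (𝓝[T ∩ Set.Iio t] t) (𝓝 ‖x t‖) :=
        (((hx t ht hat.le).continuousWithinAt hT ht).mono Set.inter_subset_left).norm
      have hr : Tendsto (fun s => Real.exp ((K + ε) * (s - a)) * (‖x a‖ + ε))
          (𝓝[T ∩ Set.Iio t] t) (𝓝 (Real.exp ((K + ε) * (t - a)) * (‖x a‖ + ε))) := by
        apply Tendsto.mono_left _ nhdsWithin_le_nhds
        exact Continuous.tendsto (by fun_prop) t
      refine le_of_tendsto_of_tendsto hc hr ?_
      filter_upwards [self_mem_nhdsWithin, nhdsWithin_le_nhds (lt_mem_nhds hat)] with s hs has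
      exact hp s hs.1 has.le hs.2
  intro t ht hat
  have hlim : Tendsto (fun ε => Real.exp ((K + ε) * (t - a)) * (‖x a‖ + ε)) (𝓝[>] 0)
      (𝓝 (Real.exp ((K + 0) * (t - a)) * (‖x a‖ + 0))) := by
    apply Tendsto.mono_left _ nhdsWithin_le_nhds
    exact Continuous.tendsto (by fun_prop) 0
  rw [add_zero, add_zero] at hlim
  refine ge_of_tendsto hlim ?_
  filter_upwards [self_mem_nhdsWithin] with ε hε
  exact key ε hε t ht hat

/-- Grönwall with rate `0`, applied to `x - x a`. -/
theorem IsTimeScale.eq_of_hasDeltaDerivAt_zero (hT : IsTimeScale T) {a : ℝ} (haT : a ∈ T)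
    {x : ℝ → E} (hx : ∀ t ∈ T, a ≤ t → HasDeltaDerivAt T x 0 t) :
    ∀ t ∈ T, a ≤ t → x t = x a := by
  intro t ht hat
  have h := hT.norm_le_exp_mul haT le_rfl (x := fun s => x s - x a) (x' := fun _ => 0)
    (fun s hs has => by simpa using (hx s hs has).sub hT hs (hasDeltaDerivAt_const (x a) s))
    (fun s _ _ => by simp) t ht hat
  simpa [sub_eq_zero] using h

end Gronwall

/-! ### Δ-integration as Lebesgue integration of a function constant on gaps -/

section Floor

variable {T : Set ℝ} {t s τ : ℝ}

/-- The last point of `T` not exceeding `τ`. -/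
noncomputable def floorIn (T : Set ℝ) (τ : ℝ) : ℝ := sSup (T ∩ Set.Iic τ)

theorem bddAbove_inter_Iic (T : Set ℝ) (τ : ℝ) : BddAbove (T ∩ Set.Iic τ) :=
  ⟨τ, fun _ h => h.2⟩

theorem le_floorIn (hs : s ∈ T) (h : s ≤ τ) : s ≤ floorIn T τ :=
  le_csSup (bddAbove_inter_Iic T τ) ⟨hs, h⟩

theorem floorIn_le (hs : s ∈ T) (h : s ≤ τ) : floorIn T τ ≤ τ :=
  csSup_le ⟨s, hs, h⟩ fun _ hr => hr.2

/-- The default `sSup ∅ = 0` is itself a point of the time scale, so `floorIn T` maps the whole line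
into `T`. -/
theorem floorIn_of_neg (h0 : T ⊆ Set.Ici 0) (hτ : τ < 0) : floorIn T τ = 0 := by
  have : T ∩ Set.Iic τ = ∅ := by
    ext s
    simp only [Set.mem_inter_iff, Set.mem_Iic, Set.mem_empty_iff_false, iff_false, not_and, not_le]
    exact fun hs => hτ.trans_le (h0 hs)
  rw [floorIn, this, Real.sSup_empty]

theorem IsTimeScale.floorIn_mem (hT : IsTimeScale T) (τ : ℝ) : floorIn T τ ∈ T := by
  rcases (T ∩ Set.Iic τ).eq_empty_or_nonempty with h | h
  · rw [floorIn, h, Real.sSup_empty]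
    exact hT.zero_mem
  · exact hT.isClosed.closure_subset_iff.2 Set.inter_subset_left
      (csSup_mem_closure h (bddAbove_inter_Iic T τ))

theorem floorIn_eq_of_mem_Ico (ht : t ∈ T) (hτ : τ ∈ Set.Ico t (sigma T t)) :
    floorIn T τ = t := by
  refine le_antisymm (csSup_le ⟨t, ht, hτ.1⟩ fun s hs => ?_) (le_floorIn ht hτ.1)
  by_contra! h
  exact absurd (sigma_le hs.1 h) (not_le.2 (hs.2.trans_lt hτ.2))

theorem IsTimeScale.lt_sigma_floorIn (hT : IsTimeScale T) (hτ : floorIn T τ < τ) :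
    τ < sigma T (floorIn T τ) := by
  by_contra! h
  have h1 := le_floorIn (hT.sigma_mem _) h
  have h2 : sigma T (floorIn T τ) = floorIn T τ := le_antisymm h1 (hT.le_sigma _)
  obtain ⟨r, ⟨hr, hlt⟩, hrτ⟩ := exists_lt_of_csInf_lt (hT.nonempty_gt (floorIn T τ))
    (show sInf {s | s ∈ T ∧ floorIn T τ < s} < τ by
      change sigma T (floorIn T τ) < τ
      rwa [h2])
  exact absurd (le_floorIn hr hrτ.le) (not_le.2 hlt)

/-- An rd-continuous function extended to be constant on the gaps of the time scale is
right-continuous. -/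
theorem RdContinuous.continuousWithinAt_comp_floorIn {E : Type*} [TopologicalSpace E]
    (hT : IsTimeScale T) (h0 : T ⊆ Set.Ici 0) {f : ℝ → E} (hf : RdContinuous T f) (τ : ℝ) :
    ContinuousWithinAt (fun r => f (floorIn T r)) (Set.Ioi τ) τ := by
  rcases lt_or_ge τ 0 with hneg | hpos
  · refine (continuousWithinAt_const (b := f 0)).congr_of_eventuallyEq ?_ ?_
    · filter_upwards [nhdsWithin_le_nhds (gt_mem_nhds hneg)] with r hr
      rw [floorIn_of_neg h0 hr]
    · rw [floorIn_of_neg h0 hneg]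
  have hle := floorIn_le hT.zero_mem hpos
  have hconst : τ < sigma T (floorIn T τ) →
      ContinuousWithinAt (fun r => f (floorIn T r)) (Set.Ioi τ) τ := by
    intro h
    refine (continuousWithinAt_const (b := f (floorIn T τ))).congr_of_eventuallyEq ?_ rfl
    filter_upwards [self_mem_nhdsWithin, nhdsWithin_le_nhds (gt_mem_nhds h)] with r hr hr2
    rw [floorIn_eq_of_mem_Ico (hT.floorIn_mem τ) ⟨hle.trans (le_of_lt hr), hr2⟩]
  rcases hle.eq_or_lt with h | h
  · have hτ : τ ∈ T := h ▸ hT.floorIn_mem τ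
    rcases (hT.le_sigma τ).eq_or_lt with h' | h'
    · have hc := (hf τ hτ).1 h'.symm
      have hfl : Tendsto (floorIn T) (𝓝[>] τ) (𝓝[T] τ) := by
        refine tendsto_nhdsWithin_iff.2 ⟨?_, Eventually.of_forall hT.floorIn_mem⟩
        refine tendsto_of_tendsto_of_tendsto_of_le_of_le' (g := fun _ => τ) (h := id)
          tendsto_const_nhds nhdsWithin_le_nhds ?_ ?_
        · filter_upwards [self_mem_nhdsWithin] with r hr using le_floorIn hτ (le_of_lt hr)
        · filter_upwards [self_mem_nhdsWithin] with r hr using floorIn_le hτ (le_of_lt hr)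
      have hc' : Tendsto f (𝓝[T] τ) (𝓝 (f (floorIn T τ))) := by rw [h]; exact hc
      exact hc'.comp hfl
    · exact hconst (by rwa [h])
  · exact hconst (hT.lt_sigma_floorIn h)

end Floor

section Measurability

/-- Pointwise limit of step functions: `f` is sampled at the first point of the grid of mesh `1 / (n
+ 1)` lying strictly to the right of `t`. -/
theorem stronglyMeasurable_of_continuousWithinAt_Ioi {E : Type*} [TopologicalSpace E]
    [TopologicalSpace.PseudoMetrizableSpace E] {f : ℝ → E}
    (hf : ∀ t, ContinuousWithinAt f (Set.Ioi t) t) : MeasureTheory.StronglyMeasurable f := by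
  refine stronglyMeasurable_of_tendsto (u := atTop)
    (f := fun (n : ℕ) t => f ((⌊((n : ℝ) + 1) * t⌋ + 1) / ((n : ℝ) + 1))) (fun n => ?_) ?_
  · have h1 : MeasureTheory.StronglyMeasurable
        (fun k : ℤ => f (((k : ℝ) + 1) / ((n : ℝ) + 1))) :=
      MeasureTheory.StronglyMeasurable.of_discrete
    have h2 : Measurable fun t : ℝ => ⌊((n : ℝ) + 1) * t⌋ :=
      Int.measurable_floor.comp (measurable_const_mul _)
    exact h1.comp_measurable h2
  · rw [tendsto_pi_nhds]
    intro t
    refine (hf t).tendsto.comp (tendsto_nhdsWithin_iff.2 ⟨?_, Eventually.of_forall fun n => ?_⟩)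
    · refine tendsto_of_tendsto_of_tendsto_of_le_of_le (g := fun _ => t)
        (h := fun n : ℕ => t + 1 / ((n : ℝ) + 1)) tendsto_const_nhds ?_ ?_ ?_
      · simpa using tendsto_const_nhds.add (tendsto_one_div_add_atTop_nhds_zero_nat (𝕜 := ℝ))
      · intro n
        have hn : (0 : ℝ) < (n : ℝ) + 1 := by positivity
        change t ≤ _
        rw [le_div_iff₀ hn]
        linarith [(Int.lt_floor_add_one (((n : ℝ) + 1) * t)).le]
      · intro n
        have hn : (0 : ℝ) < (n : ℝ) + 1 := by positivity
        change _ ≤ t + 1 / ((n : ℝ) + 1)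
        have e : (t + 1 / ((n : ℝ) + 1)) * ((n : ℝ) + 1) = ((n : ℝ) + 1) * t + 1 := by field_simp
        rw [div_le_iff₀ hn, e]
        linarith [Int.floor_le (((n : ℝ) + 1) * t)]
    · have hn : (0 : ℝ) < (n : ℝ) + 1 := by positivity
      rw [Set.mem_Ioi, lt_div_iff₀ hn]
      linarith [Int.lt_floor_add_one (((n : ℝ) + 1) * t)]

end Measurability

section Primitive

variable {T : Set ℝ} {E : Type*} [NormedAddCommGroup E] [NormedSpace ℝ E] [CompleteSpace E]

/-- Fundamental theorem of calculus on a time scale. -/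
theorem RdContinuous.hasDeltaDerivAt_integral (hT : IsTimeScale T) {g : ℝ → E}
    (hg : RdContinuous T g)
    (hint : ∀ a b, IntervalIntegrable (fun τ => g (floorIn T τ)) MeasureTheory.volume a b)
    {t : ℝ} (ht : t ∈ T) :
    HasDeltaDerivAt T (fun r => ∫ τ in (0 : ℝ)..r, g (floorIn T τ)) (g t) t := by
  rcases (hT.le_sigma t).eq_or_lt with h | h
  · intro ε hε
    have hc := (hg t ht).1 h.symm
    rw [Metric.continuousWithinAt_iff] at hc
    obtain ⟨δ, hδ, hc⟩ := hc ε hε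
    filter_upwards [self_mem_nhdsWithin, nhdsWithin_le_nhds (Metric.ball_mem_nhds t hδ)]
      with s hs hsδ
    rw [← h]
    have e : (∫ τ in (0 : ℝ)..t, g (floorIn T τ)) - (∫ τ in (0 : ℝ)..s, g (floorIn T τ))
        - (t - s) • g t = ∫ τ in s..t, (g (floorIn T τ) - g t) := by
      rw [intervalIntegral.integral_sub (hint _ _) intervalIntegrable_const,
        intervalIntegral.integral_const, intervalIntegral.integral_interval_sub_left
        (hint _ _) (hint _ _)]
    rw [e]
    refine intervalIntegral.norm_integral_le_of_norm_le_const fun τ hτ => ?_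
    rw [← dist_eq_norm]
    refine (hc (hT.floorIn_mem τ) ?_).le
    rw [Metric.mem_ball, Real.dist_eq] at hsδ
    rw [Real.dist_eq]
    -- Since `s` and `t` both belong to `T`, the floor of a point between them stays between them,
    -- hence within `δ` of `t`.
    rcases le_total s t with hst | hst
    · rw [Set.uIoc_of_le hst] at hτ
      have h1 := le_floorIn hs hτ.1.le
      have h2 := floorIn_le hs hτ.1.le
      rw [abs_lt] at hsδ ⊢
      constructor <;> linarith [hτ.2]
    · rw [Set.uIoc_of_ge hst] at hτ
      have h1 := le_floorIn ht hτ.1.le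
      have h2 := floorIn_le ht hτ.1.le
      rw [abs_lt] at hsδ ⊢
      constructor <;> linarith [hτ.2]
  · rw [hasDeltaDerivAt_iff_of_rightScattered ht h]
    refine ⟨(intervalIntegral.continuous_primitive hint 0).continuousWithinAt, ?_⟩
    rw [← intervalIntegral.integral_add_adjacent_intervals (hint 0 t) (hint t (sigma T t))]
    congr 1
    have : ∫ τ in t..sigma T t, g (floorIn T τ) = ∫ _ in t..sigma T t, g t := by
      refine intervalIntegral.integral_congr_ae ?_
      -- At the right endpoint the floor jumps to `σ(t)`, so the integrand equals `g t` only off a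
      -- null set.
      have : ∀ᵐ τ : ℝ, τ ≠ sigma T t := by
        simp [MeasureTheory.ae_iff]
      filter_upwards [this] with τ hne hτ
      rw [Set.uIoc_of_le h.le] at hτ
      rw [floorIn_eq_of_mem_Ico ht ⟨hτ.1.le, lt_of_le_of_ne hτ.2 hne⟩]
    rw [this, intervalIntegral.integral_const, mu]

end Primitive

/-! ### Global solvability of linear dynamic equations -/

section Existence

open MeasureTheory BoundedContinuousFunction

variable {T : Set ℝ} {E : Type*} [NormedAddCommGroup E]

theorem intervalIntegrable_comp_floorIn (hT : IsTimeScale T) (h0 : T ⊆ Set.Ici 0) {g : ℝ → E}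
    (hg : RdContinuous T g) {b : ℝ → ℝ} (hb : Continuous b)
    (hgb : ∀ τ, ‖g (floorIn T τ)‖ ≤ b τ) (p q : ℝ) :
    IntervalIntegrable (fun τ => g (floorIn T τ)) volume p q := by
  refine (hb.intervalIntegrable p q).mono_fun' ?_ (Eventually.of_forall hgb)
  exact (stronglyMeasurable_of_continuousWithinAt_Ioi
    (hg.continuousWithinAt_comp_floorIn hT h0)).aestronglyMeasurable

/-- The weight `e^{2Kt}`, with twice the Lipschitz rate, makes the Picard operator contract by `1 /
2` on the whole half line. -/
theorem integral_exp_weight_le {K : ℝ} (hK : 0 < K) (c : ℝ) (hc : 0 ≤ c) {t : ℝ} :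
    Real.exp (-(2 * K * t)) * (∫ τ in (0 : ℝ)..t, K * (Real.exp (2 * K * τ) * c)) ≤ c / 2 := by
  have e : ∫ τ in (0 : ℝ)..t, K * (Real.exp (2 * K * τ) * c)
      = (Real.exp (2 * K * t) - 1) * (c / 2) := by
    rw [intervalIntegral.integral_const_mul, intervalIntegral.integral_mul_const,
      intervalIntegral.integral_comp_mul_left (fun x => Real.exp x) (by positivity : 2 * K ≠ 0),
      integral_exp]
    simp only [mul_zero, Real.exp_zero, smul_eq_mul]
    field_simp
  rw [e, ← mul_assoc, mul_sub, ← Real.exp_add, neg_add_cancel, Real.exp_zero]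
  have := Real.exp_pos (-(2 * K * t))
  nlinarith

/-- Linear dynamic equations with bounded rd-continuous coefficients are solvable. -/
theorem exists_linear_solution [NormedSpace ℝ E] [CompleteSpace E] (hT : IsTimeScale T) (h0 : T ⊆ Set.Ici 0)
    {A : ℝ → E →L[ℝ] E} (hA : RdContinuous T A) {K : ℝ} (hAK : ∀ t ∈ T, ‖A t‖ ≤ K) (x₀ : E) :
    ∃ x : ℝ → E, x 0 = x₀ ∧ ∀ t ∈ T, HasDeltaDerivAt T x (A t (x t)) t := by
  wlog hK : 0 < K generalizing K
  · exact this (K := |K| + 1) (fun t ht => (hAK t ht).trans ((le_abs_self K).trans (by linarith)))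
      (by positivity)
  -- Bielecki's norm: the unknown is `z = x / w`, sought among bounded continuous functions on the
  -- line.
  set w : ℝ → ℝ := fun t => Real.exp (2 * K * t) with hw
  have hwpos : ∀ t, 0 < w t := fun t => Real.exp_pos _
  have hwc : Continuous w := by fun_prop
  have hwinv : ∀ t, Real.exp (-(2 * K * t)) * w t = 1 := fun t => by
    rw [hw, ← Real.exp_add, neg_add_cancel, Real.exp_zero]
  set g : (ℝ →ᵇ E) → ℝ → E := fun z t => A t (w t • z t) with hgdef
  have hgrd : ∀ z, RdContinuous T (g z) := fun z =>
    RdContinuous.comp₂ (φ := fun (L : E →L[ℝ] E) (v : E) => L v) (by fun_prop) hA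
      (RdContinuous.of_continuousOn (hwc.smul z.continuous).continuousOn)
  have hfl : ∀ τ, floorIn T τ ≤ max τ 0 := by
    intro τ
    rcases lt_or_ge τ 0 with h | h
    · rw [floorIn_of_neg h0 h]
      exact le_max_right _ _
    · exact (floorIn_le hT.zero_mem h).trans (le_max_left _ _)
  have hgle : ∀ z τ, ‖g z (floorIn T τ)‖ ≤ K * (w (max τ 0) * ‖z‖) := by
    intro z τ
    refine (ContinuousLinearMap.le_opNorm _ _).trans ?_
    rw [norm_smul, Real.norm_of_nonneg (hwpos _).le]
    have h1 : w (floorIn T τ) ≤ w (max τ 0) := 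
      Real.exp_le_exp.2 (mul_le_mul_of_nonneg_left (hfl τ) (by positivity))
    have h2 := z.norm_coe_le_norm (floorIn T τ)
    have h3 := hAK _ (hT.floorIn_mem τ)
    have h4 := hwpos (floorIn T τ)
    have h5 := hwpos (max τ 0)
    gcongr
  have hint : ∀ z p q, IntervalIntegrable (fun τ => g z (floorIn T τ)) volume p q := fun z =>
    intervalIntegrable_comp_floorIn hT h0 (hgrd z) (by fun_prop) (hgle z)
  have hIle : ∀ z, ∀ t, 0 ≤ t → ‖Real.exp (-(2 * K * t)) • ∫ τ in (0 : ℝ)..t, g z (floorIn T τ)‖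
      ≤ ‖z‖ / 2 := by
    intro z t ht
    rw [norm_smul, Real.norm_of_nonneg (Real.exp_pos _).le]
    refine le_trans ?_ (integral_exp_weight_le hK ‖z‖ (norm_nonneg z) (t := t))
    gcongr
    refine intervalIntegral.norm_integral_le_of_norm_le ht (Eventually.of_forall fun τ hτ => ?_)
      (Continuous.intervalIntegrable (by fun_prop) _ _)
    have := hgle z τ
    rwa [max_eq_left hτ.1.le] at this
  -- The Picard operator in the variable `z`; `max t 0` freezes it for negative times, where the
  -- weight would not give a bound.
  set P : (ℝ →ᵇ E) → (ℝ →ᵇ E) := fun z =>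
    BoundedContinuousFunction.ofNormedAddCommGroup
      (fun t => Real.exp (-(2 * K * max t 0)) • (x₀ + ∫ τ in (0 : ℝ)..max t 0, g z (floorIn T τ)))
      (by
        have := intervalIntegral.continuous_primitive (hint z) 0
        have h2 : Continuous fun t : ℝ => ∫ τ in (0 : ℝ)..max t 0, g z (floorIn T τ) :=
          this.comp (by fun_prop : Continuous fun t : ℝ => max t 0)
        fun_prop)
      (‖x₀‖ + ‖z‖ / 2)
      (by
        intro t
        rw [smul_add]
        refine (norm_add_le _ _).trans (add_le_add ?_ (hIle z _ (le_max_right _ _)))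
        rw [norm_smul, Real.norm_of_nonneg (Real.exp_pos _).le]
        refine mul_le_of_le_one_left (norm_nonneg _) (Real.exp_le_one_iff.2 ?_)
        have := le_max_right t 0
        have := mul_nonneg hK.le this
        linarith) with hP
  have hPapply : ∀ z t, P z t
      = Real.exp (-(2 * K * max t 0)) • (x₀ + ∫ τ in (0 : ℝ)..max t 0, g z (floorIn T τ)) :=
    fun z t => rfl
  have hcontr : ContractingWith (1 / 2) P := by
    refine ⟨by rw [← NNReal.coe_lt_coe]; norm_num, LipschitzWith.of_dist_le_mul fun z y => ?_⟩
    rw [BoundedContinuousFunction.dist_le (by positivity)]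
    intro t
    rw [dist_eq_norm, dist_eq_norm, hPapply, hPapply, ← smul_sub, add_sub_add_left_eq_sub,
      ← intervalIntegral.integral_sub (hint _ _ _) (hint _ _ _)]
    have e : ∀ τ, g z (floorIn T τ) - g y (floorIn T τ) = g (z - y) (floorIn T τ) := by
      intro τ
      simp only [hgdef, BoundedContinuousFunction.coe_sub, Pi.sub_apply, smul_sub, map_sub]
    simp only [e]
    refine (hIle (z - y) _ (le_max_right _ _)).trans (le_of_eq ?_)
    push_cast
    ring
  set z := hcontr.fixedPoint P
  have hz : P z = z := hcontr.fixedPoint_isFixedPt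
  have hx : ∀ t, 0 ≤ t → w t • z t = x₀ + ∫ τ in (0 : ℝ)..t, g z (floorIn T τ) := by
    intro t ht
    conv_lhs => rw [← hz, hPapply, max_eq_left ht, smul_smul, mul_comm, hwinv, one_smul]
  refine ⟨fun t => w t • z t, by simp [hx 0 le_rfl], fun t ht => ?_⟩
  have hd := (hgrd z).hasDeltaDerivAt_integral hT (hint z) ht
  have e : ∀ s ∈ T, w s • z s = x₀ + ∫ τ in (0 : ℝ)..s, g z (floorIn T τ) :=
    fun s hs => hx s (h0 hs)
  intro ε hε
  filter_upwards [hd ε hε, self_mem_nhdsWithin] with s hs hsT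
  rw [e s hsT, e _ (hT.sigma_mem t), add_sub_add_left_eq_sub]
  exact hs

end Existence

/-! ### Smooth staircases -/

section StepSum

variable {E : Type*} [NormedAddCommGroup E] [NormedSpace ℝ E] {L M : ℝ}

/-- The smooth staircase with jumps `v i`, the `i`-th one made on `[i L + M, i L + M + 1]`. -/
noncomputable def stepSum (L M : ℝ) (v : ℕ → E) (t : ℝ) : E :=
  ∑' i : ℕ, Real.smoothTransition (t - i * L - M) • v i

theorem stepSum_eq_sum (hL : 0 ≤ L) (v : ℕ → E) {N : ℕ} {t : ℝ} (ht : t ≤ N * L + M) :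
    stepSum L M v t = ∑ i ∈ Finset.range N, Real.smoothTransition (t - i * L - M) • v i := by
  refine tsum_eq_sum fun i hi => ?_
  rw [Finset.mem_range, not_lt] at hi
  have h1 : (N : ℝ) * L ≤ i * L := by gcongr
  rw [Real.smoothTransition.zero_of_nonpos (by linarith), zero_smul]

/-- Jump `N - 1` is over by `(N - 1) L + M + 1 ≤ N L - 1`, and jump `N + 1` starts only at `(N + 1)
L + M`. The margins are chosen so that for `t` in block `N` the range also contains a neighbourhood
of `t` and `σ(t) ≤ t + M`. -/
theorem stepSum_block (hM : 0 ≤ M) (hL : M + 2 ≤ L) (v : ℕ → E) {N : ℕ} {t : ℝ}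
    (h1 : N * L - 1 ≤ t) (h2 : t ≤ (N + 1) * L + M) :
    stepSum L M v t = ∑ i ∈ Finset.range N, v i + Real.smoothTransition (t - N * L - M) • v N := by
  rw [stepSum_eq_sum (by linarith) v (N := N + 1) (by push_cast; exact h2), Finset.sum_range_succ]
  congr 1
  refine Finset.sum_congr rfl fun i hi => ?_
  rw [Finset.mem_range] at hi
  have h3 : ((i : ℝ) + 1) * L ≤ N * L := by
    have : (i : ℝ) + 1 ≤ N := by exact_mod_cast hi
    have : 0 ≤ L := by linarith
    gcongr
  rw [Real.smoothTransition.one_of_one_le (by linarith), one_smul]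

theorem contDiff_stepSum (hM : 0 ≤ M) (hL : 0 < L) (v : ℕ → E) :
    ContDiff ℝ 1 (stepSum L M v) := by
  rw [contDiff_iff_contDiffAt]
  intro t
  obtain ⟨N, hN⟩ := exists_nat_gt (t / L)
  rw [div_lt_iff₀ hL] at hN
  have hsum : ContDiff ℝ 1 fun s => ∑ i ∈ Finset.range N,
      Real.smoothTransition (s - i * L - M) • v i := by
    refine ContDiff.sum fun i _ => ContDiff.smul ?_ contDiff_const
    exact (Real.smoothTransition.contDiff (n := 1)).comp (by fun_prop)
  refine hsum.contDiffAt.congr_of_eventuallyEq ?_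
  filter_upwards [gt_mem_nhds hN] with s hs
  exact stepSum_eq_sum hL.le v (by linarith)

theorem exists_lipschitz_smoothTransition :
    ∃ D : ℝ, 0 < D ∧ ∀ a b, |Real.smoothTransition a - Real.smoothTransition b| ≤ D * |a - b| := by
  have hcd : ContDiff ℝ 1 Real.smoothTransition := Real.smoothTransition.contDiff (n := 1)
  have hsupp : HasCompactSupport (deriv Real.smoothTransition) := by
    refine HasCompactSupport.intro (isCompact_Icc (a := (0 : ℝ)) (b := 1)) fun x hx => ?_
    rw [Set.mem_Icc, not_and_or, not_le, not_le] at hx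
    rcases hx with hx | hx
    · have : Real.smoothTransition =ᶠ[𝓝 x] fun _ => 0 := by
        filter_upwards [gt_mem_nhds hx] with y hy
        exact Real.smoothTransition.zero_of_nonpos hy.le
      rw [this.deriv_eq, deriv_const]
    · have : Real.smoothTransition =ᶠ[𝓝 x] fun _ => 1 := by
        filter_upwards [lt_mem_nhds hx] with y hy
        exact Real.smoothTransition.one_of_one_le hy.le
      rw [this.deriv_eq, deriv_const]
  obtain ⟨C, hC⟩ := (hcd.continuous_deriv le_rfl).bounded_above_of_compact_support hsupp
  have hC0 : 0 ≤ C := (norm_nonneg _).trans (hC 0)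
  refine ⟨C + 1, by linarith, fun a b => ?_⟩
  have := convex_univ.norm_image_sub_le_of_norm_deriv_le (f := Real.smoothTransition)
    (fun x _ => hcd.differentiable (by simp) x) (fun x _ => hC x) (Set.mem_univ b) (Set.mem_univ a)
  rw [Real.norm_eq_abs, Real.norm_eq_abs] at this
  nlinarith [abs_nonneg (a - b)]

end StepSum

/-! ### Generalized exponentials with a prescribed `C¹` logarithm -/

section GeneralizedExponential

variable {T : Set ℝ} {G : ℝ → ℝ}

/-- The function `u` whose generalized exponential is `exp (G t - G s)`. -/
noncomputable def expRate (T : Set ℝ) (G : ℝ → ℝ) (t : ℝ) : ℝ :=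
  Real.exp (-G t) * dslope (fun s => Real.exp (G s)) t (sigma T t)

theorem rdContinuous_expRate (hT : IsTimeScale T) (hG : ContDiff ℝ 1 G) :
    RdContinuous T (expRate T G) := by
  refine RdContinuous.comp₂ (φ := fun x y : ℝ => x * y) continuous_mul
    (RdContinuous.of_continuousOn ?_) (rdContinuous_dslope_sigma hG.exp hT)
  have := hG.continuous
  exact Continuous.continuousOn (by fun_prop)

theorem one_add_mu_mul_expRate (T : Set ℝ) (G : ℝ → ℝ) (t : ℝ) :
    1 + mu T t * expRate T G t = Real.exp (G (sigma T t) - G t) := by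
  have h := sub_smul_dslope (fun s => Real.exp (G s)) t (sigma T t)
  rw [smul_eq_mul] at h
  have e : mu T t * expRate T G t = Real.exp (-G t) *
      ((sigma T t - t) * dslope (fun s => Real.exp (G s)) t (sigma T t)) := by
    rw [expRate, mu]; ring
  rw [e, h, mul_sub, ← Real.exp_add, ← Real.exp_add, neg_add_cancel, Real.exp_zero]
  rw [add_sub_cancel, neg_add_eq_sub]

/-- The cylinder transformation undoes the exponential, in the dense and in the scattered case
alike, leaving the Δ-derivative of `G`. Hence `G` is the antiderivative sought. -/
theorem cylinder_expRate (hG : ContDiff ℝ 1 G) (t : ℝ) :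
    cylinder (mu T t) (expRate T G t) = dslope G t (sigma T t) := by
  unfold cylinder
  split_ifs with h
  · have hs : sigma T t = t := sub_eq_zero.1 h
    have hd := (hG.differentiable (by simp) t).hasDerivAt.exp.deriv
    rw [expRate, hs, dslope_same, dslope_same, hd, ← mul_assoc, ← Real.exp_add, neg_add_cancel,
      Real.exp_zero, one_mul]
  · have hs : sigma T t ≠ t := fun e => h (by simp [mu, e])
    rw [mul_comm (expRate T G t), one_add_mu_mul_expRate, Real.log_exp, dslope_of_ne _ hs,
      slope_def_field, mu]

/-- The antiderivative picked in `deltaIntegral` is arbitrary, but it differs from `G` by a constant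
on `T`. -/
theorem logGenExp_expRate (hT : IsTimeScale T) (h0 : T ⊆ Set.Ici 0) (hG : ContDiff ℝ 1 G)
    {s t : ℝ} (hs : s ∈ T) (ht : t ∈ T) : logGenExp T (expRate T G) t s = G t - G s := by
  unfold logGenExp deltaIntegral
  have hder : IsDeltaAntideriv T (fun τ => cylinder (mu T τ) (expRate T G τ)) G := by
    intro r hr
    simp only [cylinder_expRate hG]
    exact hasDeltaDerivAt_of_contDiff hG hT hr
  have hex : ∃ H : ℝ → ℝ, IsDeltaAntideriv T (fun τ => cylinder (mu T τ) (expRate T G τ)) H :=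
    ⟨G, hder⟩
  rw [dif_pos hex]
  have key : ∀ r ∈ T, hex.choose r - G r = hex.choose 0 - G 0 := fun r hr =>
    hT.eq_of_hasDeltaDerivAt_zero hT.zero_mem (x := fun r => hex.choose r - G r)
      (fun q hq _ => by simpa using (hex.choose_spec q hq).sub hT hq (hder q hq)) r hr (h0 hr)
  linarith [key s hs, key t ht]

end GeneralizedExponential

/-! ### The fundamental matrix and its inverse -/

section Inverse

variable {T : Set ℝ} {R : Type*} [NormedRing R] [NormedAlgebra ℝ R] [HasSummableGeomSeries R]

/-- At right-dense points, and in left-sided limits at left-dense points, `μ` tends to `0` and `1 +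
μ A` tends to `1`. Only continuity of inversion at `1` is involved. -/
theorem rdContinuous_inverse_one_add (hT : IsTimeScale T) {A : ℝ → R} (hA : RdContinuous T A) :
    RdContinuous T fun t => Ring.inverse (1 + mu T t • A t) := by
  have hinv : ContinuousAt (Ring.inverse : R → R) 1 := by
    simpa using NormedRing.inverse_continuousAt (1 : Rˣ)
  intro t ht
  refine ⟨fun h => ?_, fun h => ⟨Ring.inverse 1, ?_⟩⟩
  · have hμ := (hT.rdContinuous_mu t ht).1 h
    have hf : ContinuousWithinAt (fun t => 1 + mu T t • A t) T t :=
      continuousWithinAt_const.add (hμ.smul ((hA t ht).1 h))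
    have e : 1 + mu T t • A t = 1 := by simp [mu, h]
    refine ContinuousAt.comp_continuousWithinAt (g := Ring.inverse)
      (f := fun t => 1 + mu T t • A t) ?_ hf
    rwa [e]
  · have hμ : Tendsto (mu T) (𝓝[T ∩ Set.Iio t] t) (𝓝 0) := by
      have := (hT.tendsto_sigma_of_leftDense ht).sub (tendsto_id.mono_left nhdsWithin_le_nhds)
      rw [sub_self] at this
      exact this
    obtain ⟨l, hl⟩ := (hA t ht).2 h
    have := (tendsto_const_nhds (x := (1 : R))).add (hμ.smul hl)
    rw [zero_smul, add_zero] at this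
    exact hinv.tendsto.comp this

end Inverse

section Matrices

variable {𝕜 : Type*} [RCLike 𝕜] {n : ℕ} {T : Set ℝ}

noncomputable instance instNormedAlgebraRealMatrix : NormedAlgebra ℝ (Matrix (Fin n) (Fin n) 𝕜) where
  norm_smul_le r A := by
    have : r • A = (r : 𝕜) • A := by
      ext i j
      simp [RCLike.real_smul_eq_coe_mul]
    rw [this, norm_smul, RCLike.norm_ofReal, Real.norm_eq_abs]

theorem l2_opNorm_one_le : ‖(1 : Matrix (Fin n) (Fin n) 𝕜)‖ ≤ 1 := by
  rcases isEmpty_or_nonempty (Fin n) with h | h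
  · rw [Subsingleton.elim (1 : Matrix (Fin n) (Fin n) 𝕜) 0, norm_zero]
    exact zero_le_one
  · exact norm_one.le

/-- `X` is a fundamental solution of `x^Δ = A x` on `T`, with inverse `Y` and with exponential bounds
on the transition matrices. -/
structure IsFundamentalPair (T : Set ℝ) (A X Y : ℝ → Matrix (Fin n) (Fin n) 𝕜) (K : ℝ) : Prop where
  deriv : ∀ t ∈ T, HasDeltaDerivAt T X (A t * X t) t
  mul_inv : ∀ t ∈ T, X t * Y t = 1
  inv_mul : ∀ t ∈ T, Y t * X t = 1
  norm_forward : ∀ s ∈ T, ∀ t ∈ T, s ≤ t → ‖X t * Y s‖ ≤ Real.exp (K * (t - s))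
  norm_backward : ∀ s ∈ T, ∀ t ∈ T, s ≤ t → ‖X s * Y t‖ ≤ Real.exp (K * (t - s))

/-- `Y` is built as the solution of `Y^Δ = Y D` with `D = -A (1 + μ A)⁻¹`, the equation that the
inverse of `X` must satisfy; then `Y X` has zero derivative. Uniform regressivity bounds `D`, so
Grönwall gives the backward estimate as well as the forward one. -/
theorem exists_isFundamentalPair (hT : IsTimeScale T) (h0 : T ⊆ Set.Ici 0)
    {A : ℝ → Matrix (Fin n) (Fin n) 𝕜} (hA : RdContinuous T A) (hb : IsBounded T A)
    (hreg : IsUniformlyRegressive T A) :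
    ∃ X Y K, 0 < K ∧ (∀ t ∈ T, ‖A t‖ ≤ K) ∧ IsFundamentalPair T A X Y K := by
  obtain ⟨K₁, hK₁⟩ := hb
  obtain ⟨hunit, K₂, hK₂⟩ := hreg
  set J : ℝ → Matrix (Fin n) (Fin n) 𝕜 := fun t => (1 + mu T t • A t)⁻¹ with hJ
  have hJrd : RdContinuous T J := by
    have := rdContinuous_inverse_one_add hT hA
    simpa only [hJ, Matrix.nonsing_inv_eq_ringInverse] using this
  have hK₁0 : 0 ≤ K₁ := (norm_nonneg _).trans (hK₁ 0 hT.zero_mem)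
  have hK₂0 : 0 ≤ K₂ := (norm_nonneg _).trans (hK₂ 0 hT.zero_mem)
  set D : ℝ → Matrix (Fin n) (Fin n) 𝕜 := fun t => -(A t * J t) with hD
  have hDrd : RdContinuous T D := RdContinuous.comp₂ (φ := fun x y => -(x * y)) (by fun_prop) hA hJrd
  set K := K₁ + K₁ * K₂ + 1 with hK
  have hKpos : 0 < K := by positivity
  have hAK : ∀ t ∈ T, ‖A t‖ ≤ K := fun t ht => by nlinarith [hK₁ t ht, mul_nonneg hK₁0 hK₂0]
  have hDK : ∀ t ∈ T, ‖D t‖ ≤ K := fun t ht => by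
    rw [hD, norm_neg]
    have : ‖A t * J t‖ ≤ K₁ * K₂ := (norm_mul_le _ _).trans
      (mul_le_mul (hK₁ t ht) (hK₂ t ht) (norm_nonneg _) hK₁0)
    linarith
  obtain ⟨X, hX0, hX⟩ := exists_linear_solution hT h0
    (A := fun t => ContinuousLinearMap.mul ℝ (Matrix (Fin n) (Fin n) 𝕜) (A t))
    (hA.comp (ContinuousLinearMap.continuous _))
    (fun t ht => (ContinuousLinearMap.opNorm_mul_apply_le ℝ _ _).trans (hAK t ht)) 1
  obtain ⟨Y, hY0, hY⟩ := exists_linear_solution hT h0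
    (A := fun t => (ContinuousLinearMap.mul ℝ (Matrix (Fin n) (Fin n) 𝕜)).flip (D t))
    (hDrd.comp (ContinuousLinearMap.continuous _))
    (fun t ht => (ContinuousLinearMap.opNorm_le_bound _ hKpos.le fun x => by
      rw [ContinuousLinearMap.flip_apply, ContinuousLinearMap.mul_apply', mul_comm K]
      exact (norm_mul_le _ _).trans (mul_le_mul_of_nonneg_left (hDK t ht) (norm_nonneg _)))) 1
  simp only [ContinuousLinearMap.mul_apply', ContinuousLinearMap.flip_apply] at hX hY
  have hinv : ∀ t ∈ T, Y t * X t = 1 := by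
    intro t ht
    have hc := hT.eq_of_hasDeltaDerivAt_zero hT.zero_mem (x := fun t => Y t * X t)
      (fun s hs _ => by
        have hb := (hY s hs).bilinear (ContinuousLinearMap.mul ℝ (Matrix (Fin n) (Fin n) 𝕜)) hT hs
          (hX s hs)
        simp only [ContinuousLinearMap.mul_apply'] at hb
        convert hb using 1
        rw [(hY s hs).apply_sigma hT hs]
        have hdet := (Matrix.isUnit_iff_isUnit_det _).1 (hunit s hs)
        have hJ1 : (1 + mu T s • A s) * J s = 1 := Matrix.mul_nonsing_inv _ hdet
        have hJ2 : J s * (1 + mu T s • A s) = 1 := Matrix.nonsing_inv_mul _ hdet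
        -- With `1 + μ D = J` one has `Y(σ(s)) = Y J`, so the derivative of `Y X` is `Y (J A - A J)
        -- X`, which vanishes by this commutation.
        have hcomm : A s * J s = J s * A s := by
          have h1 : J s * ((1 + mu T s • A s) * A s) * J s
              = J s * (A s * (1 + mu T s • A s)) * J s := by
            congr 2
            rw [add_mul, mul_add, one_mul, mul_one, smul_mul_assoc, mul_smul_comm]
          rw [← mul_assoc (J s), hJ2, one_mul, mul_assoc (J s), mul_assoc (A s), hJ1, mul_one] at h1
          exact h1
        have e : (1 + mu T s • D s) = J s := by
          have h3 : 1 + mu T s • D s = (1 + mu T s • A s) * J s - mu T s • (A s * J s) := by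
            rw [hJ1, hD, smul_neg]
            abel
          rw [h3, add_mul, one_mul, smul_mul_assoc]
          abel
        have e2 : Y s + mu T s • (Y s * D s) = Y s * J s := by
          rw [← e, mul_add, mul_one, mul_smul_comm]
        rw [e2, ← mul_assoc, mul_assoc (Y s) (J s), ← hcomm, ← add_mul, ← mul_add, hD]
        simp)
      t ht (h0 ht)
    rw [hc, hX0, hY0, one_mul]
  have hinv' : ∀ t ∈ T, X t * Y t = 1 := fun t ht => mul_eq_one_comm.1 (hinv t ht)
  refine ⟨X, Y, K, hKpos, hAK, hX, hinv', hinv, fun s hs t ht hst => ?_, fun s hs t ht hst => ?_⟩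
  · have hg := hT.norm_le_exp_mul hs hKpos.le (x := fun r => X r * Y s)
      (x' := fun r => A r * (X r * Y s))
      (fun r hr _ => by
        have := (hX r hr).clm_apply
          ((ContinuousLinearMap.mul ℝ (Matrix (Fin n) (Fin n) 𝕜)).flip (Y s)) hT hr
        simpa [mul_assoc] using this)
      (fun r hr _ => (norm_mul_le _ _).trans
        (mul_le_mul_of_nonneg_right (hAK r hr) (norm_nonneg _))) t ht hst
    rw [hinv' s hs] at hg
    exact hg.trans (mul_le_of_le_one_right (Real.exp_pos _).le l2_opNorm_one_le)
  · have hg := hT.norm_le_exp_mul hs hKpos.le (x := fun r => X s * Y r)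
      (x' := fun r => X s * Y r * D r)
      (fun r hr _ => by
        have := (hY r hr).clm_apply
          (ContinuousLinearMap.mul ℝ (Matrix (Fin n) (Fin n) 𝕜) (X s)) hT hr
        simpa [mul_assoc] using this)
      (fun r hr _ => (norm_mul_le _ _).trans (by
        rw [mul_comm]
        exact mul_le_mul_of_nonneg_right (hDK r hr) (norm_nonneg _))) t ht hst
    rw [hinv' s hs] at hg
    exact hg.trans (mul_le_of_le_one_right (Real.exp_pos _).le l2_opNorm_one_le)

end Matrices

/-! ### Matrices acting on Euclidean space; the displacement lemma -/

section Action

variable {𝕜 : Type*} [RCLike 𝕜] {n : ℕ}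

theorem norm_toEuclideanLin_le (A : Matrix (Fin n) (Fin n) 𝕜) (v : EuclideanSpace 𝕜 (Fin n)) :
    ‖Matrix.toEuclideanLin A v‖ ≤ ‖A‖ * ‖v‖ := by
  rw [Matrix.l2_opNorm_def]
  exact ContinuousLinearMap.le_opNorm (LinearMap.toContinuousLinearMap (Matrix.toEuclideanLin A)) v

/-- Matrices acting on Euclidean space, as a continuous real bilinear map. -/
noncomputable def matrixAction :
    Matrix (Fin n) (Fin n) 𝕜 →L[ℝ] EuclideanSpace 𝕜 (Fin n) →L[ℝ] EuclideanSpace 𝕜 (Fin n) :=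
  LinearMap.mkContinuous₂
    (LinearMap.mk₂ ℝ (fun A v => Matrix.toEuclideanLin A v)
      (fun A B v => by rw [map_add, LinearMap.add_apply])
      (fun c A v => by
        ext i
        simp [Matrix.toLpLin_apply, Matrix.smul_mulVec])
      (fun A v w => map_add _ _ _)
      (fun c A v => by
        ext i
        simp [Matrix.toLpLin_apply]))
    1 (fun A v => by rw [one_mul]; exact norm_toEuclideanLin_le A v)

theorem matrixAction_apply (A : Matrix (Fin n) (Fin n) 𝕜) (v : EuclideanSpace 𝕜 (Fin n)) :
    matrixAction A v = Matrix.toEuclideanLin A v := rfl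

theorem norm_matrixAction_le (A : Matrix (Fin n) (Fin n) 𝕜) (v : EuclideanSpace 𝕜 (Fin n)) :
    ‖matrixAction A v‖ ≤ ‖A‖ * ‖v‖ := norm_toEuclideanLin_le A v

theorem matrixAction_mul (A B : Matrix (Fin n) (Fin n) 𝕜) (v : EuclideanSpace 𝕜 (Fin n)) :
    matrixAction (A * B) v = matrixAction A (matrixAction B v) := by
  simp only [matrixAction_apply]
  ext i
  simp [Matrix.toLpLin_apply, Matrix.mulVec_mulVec]

theorem matrixAction_one (v : EuclideanSpace 𝕜 (Fin n)) :
    matrixAction (1 : Matrix (Fin n) (Fin n) 𝕜) v = v := by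
  rw [matrixAction_apply]
  ext i
  simp

theorem continuous_matrixAction :
    Continuous fun p : Matrix (Fin n) (Fin n) 𝕜 × EuclideanSpace 𝕜 (Fin n) =>
      matrixAction p.1 p.2 :=
  (matrixAction.continuous.comp continuous_fst).clm_apply continuous_snd

theorem exists_norm_le_one_half_opNorm_le (A : Matrix (Fin n) (Fin n) 𝕜) :
    ∃ e : EuclideanSpace 𝕜 (Fin n), ‖e‖ ≤ 1 ∧ ‖A‖ / 2 ≤ ‖matrixAction A e‖ := by
  rcases (norm_nonneg A).eq_or_lt with h | h
  · exact ⟨0, by simp, by simp [← h]⟩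
  · have hlt : ‖A‖ / 2 < ‖LinearMap.toContinuousLinearMap (Matrix.toEuclideanLin A)‖ := by
      have := Matrix.l2_opNorm_def A
      rw [LinearEquiv.trans_apply] at this
      rw [← this]
      linarith
    obtain ⟨e, he, h2⟩ := ContinuousLinearMap.exists_lt_apply_of_lt_opNorm _ hlt
    exact ⟨e, he.le, h2.le⟩

/-- A small displacement of `y` makes `A` act on it with almost its full norm. -/
theorem exists_kick (A : Matrix (Fin n) (Fin n) 𝕜) (y : EuclideanSpace 𝕜 (Fin n)) {ε : ℝ}
    (hε : 0 ≤ ε) :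
    ∃ w, ‖w‖ ≤ ε * ‖y‖ ∧ ε / 2 * ‖A‖ * ‖y‖ ≤ ‖matrixAction A (y + w)‖ := by
  obtain ⟨e, he, hAe⟩ := exists_norm_le_one_half_opNorm_le A
  set w := (ε * ‖y‖) • e with hw
  have hwn : ‖w‖ ≤ ε * ‖y‖ := by
    rw [hw, norm_smul, Real.norm_of_nonneg (by positivity)]
    exact mul_le_of_le_one_right (by positivity) he
  -- The images of `y + w` and `y - w` differ by `2 ε ‖y‖ A e`, so they cannot both be short: one of
  -- the two signs works.
  have hsum : ε * ‖A‖ * ‖y‖ ≤ ‖matrixAction A (y + w)‖ + ‖matrixAction A (y + -w)‖ := by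
    have e1 : matrixAction A (y + w) - matrixAction A (y + -w)
        = (2 * (ε * ‖y‖)) • matrixAction A e := by
      rw [← map_sub, ← map_smul, hw]
      congr 1
      module
    have h1 := norm_sub_le (matrixAction A (y + w)) (matrixAction A (y + -w))
    rw [e1, norm_smul, Real.norm_of_nonneg (by positivity)] at h1
    refine le_trans ?_ h1
    calc ε * ‖A‖ * ‖y‖ = 2 * (ε * ‖y‖) * (‖A‖ / 2) := by ring
      _ ≤ _ := by gcongr
  rcases le_total ‖matrixAction A (y + -w)‖ ‖matrixAction A (y + w)‖ with h | h
  · exact ⟨w, hwn, by linarith⟩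
  · exact ⟨-w, by rwa [norm_neg], by linarith⟩

end Action

/-! ### From a perturbed solution to a perturbed matrix -/

section Perturbation

variable {𝕜 : Type*} [RCLike 𝕜] {n : ℕ}

/-- The rank one matrix `g x^*`. -/
noncomputable def rankOneMatrix (g x : EuclideanSpace 𝕜 (Fin n)) : Matrix (Fin n) (Fin n) 𝕜 :=
  Matrix.vecMulVec g.ofLp (star x.ofLp)

theorem toEuclideanLin_rankOneMatrix (g x z : EuclideanSpace 𝕜 (Fin n)) :
    Matrix.toEuclideanLin (rankOneMatrix g x) z = inner 𝕜 x z • g := by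
  ext i
  simp only [rankOneMatrix, Matrix.toLpLin_apply, Matrix.mulVec, dotProduct, Matrix.vecMulVec_apply,
    PiLp.inner_apply, PiLp.smul_apply, smul_eq_mul, Finset.sum_mul, Pi.star_apply]
  refine Finset.sum_congr rfl fun j _ => ?_
  simp only [RCLike.inner_apply, RCLike.star_def]
  ring

theorem norm_rankOneMatrix_le (g x : EuclideanSpace 𝕜 (Fin n)) :
    ‖rankOneMatrix g x‖ ≤ ‖g‖ * ‖x‖ := by
  rw [Matrix.l2_opNorm_def, LinearEquiv.trans_apply]
  refine ContinuousLinearMap.opNorm_le_bound _ (by positivity) fun z => ?_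
  rw [LinearMap.coe_toContinuousLinearMap', toEuclideanLin_rankOneMatrix, norm_smul]
  calc _ ≤ (‖x‖ * ‖z‖) * ‖g‖ := by
        gcongr
        exact norm_inner_le_norm x z
    _ = _ := by ring

theorem continuous_rankOneMatrix :
    Continuous fun p : EuclideanSpace 𝕜 (Fin n) × EuclideanSpace 𝕜 (Fin n) =>
      rankOneMatrix p.1 p.2 := by
  unfold rankOneMatrix
  refine Continuous.matrix_vecMulVec ?_ ?_
  · fun_prop
  · fun_prop

/-- The ramp vanishes on `(-∞, 0]`, and boundedness of `B` makes the product tend to `0` at `0`, so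
nothing is required of `B` at negative times or of how `T` accumulates at `0`. -/
theorem RdContinuous.smul_cutoff {T : Set ℝ} {E : Type*} [NormedAddCommGroup E] [NormedSpace ℝ E]
    {B : ℝ → E} (hB : RdContinuous (T ∩ Set.Ici 0) B) {δ : ℝ}
    (hδ : ∀ t ∈ T ∩ Set.Ici 0, ‖B t‖ ≤ δ) :
    RdContinuous T fun t => max 0 (min t 1) • B t := by
  have hc : Continuous fun t : ℝ => max 0 (min t 1) := by fun_prop
  have hneg : ∀ t : ℝ, t ≤ 0 → max 0 (min t 1) = 0 := fun t ht =>
    max_eq_left ((min_le_left _ _).trans ht)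
  have hlim0 : Tendsto (fun t => max 0 (min t 1) • B t) (𝓝[T] 0) (𝓝 0) := by
    have hg : Tendsto (fun t : ℝ => max 0 (min t 1) * δ) (𝓝[T] 0) (𝓝 0) := by
      have h : Tendsto (fun t : ℝ => max 0 (min t 1) * δ) (𝓝 0) (𝓝 (max 0 (min 0 1) * δ)) :=
        Continuous.tendsto (by fun_prop) 0
      simp only [min_eq_left (zero_le_one' ℝ), max_self, zero_mul] at h
      exact h.mono_left nhdsWithin_le_nhds
    refine squeeze_zero_norm' ?_ hg
    filter_upwards [self_mem_nhdsWithin] with t ht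
    rw [norm_smul, Real.norm_of_nonneg (le_max_left _ _)]
    rcases le_or_gt t 0 with h | h
    · rw [hneg t h, zero_mul, zero_mul]
    · exact mul_le_mul_of_nonneg_left (hδ t ⟨ht, h.le⟩) (le_max_left _ _)
  intro t ht
  rcases lt_trichotomy t 0 with h | h | h
  · have hev : (fun t => max 0 (min t 1) • B t) =ᶠ[𝓝 t] fun _ => 0 := by
      filter_upwards [gt_mem_nhds h] with s hs
      rw [hneg s hs.le, zero_smul]
    have hcont : ContinuousAt (fun t => max 0 (min t 1) • B t) t :=
      continuousAt_const.congr hev.symm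
    exact ⟨fun _ => hcont.continuousWithinAt,
      fun _ => ⟨_, hcont.tendsto.mono_left nhdsWithin_le_nhds⟩⟩
  · subst h
    refine ⟨fun _ => ?_, fun _ => ⟨0, hlim0.mono_left (nhdsWithin_mono _ Set.inter_subset_left)⟩⟩
    unfold ContinuousWithinAt
    simpa using hlim0
  · obtain ⟨h1, h2⟩ := hB t ⟨ht, h.le⟩
    rw [sigma_inter_Ici T h.le] at h1
    have hnhds : ∀ U : Set ℝ, 𝓝[(T ∩ Set.Ici 0) ∩ U] t = 𝓝[T ∩ U] t := by
      intro U
      rw [Set.inter_right_comm, nhdsWithin_inter_of_mem']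
      exact nhdsWithin_le_nhds (Ici_mem_nhds h)
    refine ⟨fun hd => ?_, fun hd => ?_⟩
    · have h3 := h1 hd
      unfold ContinuousWithinAt at h3 ⊢
      have := hnhds Set.univ
      rw [Set.inter_univ, Set.inter_univ] at this
      rw [this] at h3
      exact (hc.continuousAt.tendsto.mono_left nhdsWithin_le_nhds).smul h3
    · rw [mem_closure_iff_nhdsWithin_neBot, hnhds] at h2
      obtain ⟨l, hl⟩ := h2 (mem_closure_iff_nhdsWithin_neBot.1 hd)
      exact ⟨_, (hc.continuousAt.tendsto.mono_left nhdsWithin_le_nhds).smul hl⟩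

/-- An unbounded, nowhere zero solution of `x^Δ = A x + g` with `|g| ≤ δ |x|` yields a destabilizing
perturbation of norm at most `δ`. -/
theorem exists_destabilizing_perturbation {T : Set ℝ} (hT : IsTimeScale T)
    {A : ℝ → Matrix (Fin n) (Fin n) 𝕜} {x g : ℝ → EuclideanSpace 𝕜 (Fin n)} {δ : ℝ}
    (hx : ∀ t ∈ T ∩ Set.Ici 0,
      HasDeltaDerivAt (T ∩ Set.Ici 0) x (matrixAction (A t) (x t) + g t) t)
    (hx0 : ∀ t ∈ T ∩ Set.Ici 0, x t ≠ 0) (hg : RdContinuous (T ∩ Set.Ici 0) g)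
    (hgx : ∀ t ∈ T ∩ Set.Ici 0, ‖g t‖ ≤ δ * ‖x t‖)
    (hub : ∀ C b : ℝ, ∃ t ∈ T, b ≤ t ∧ C < ‖x t‖) :
    ∃ B : ℝ → Matrix (Fin n) (Fin n) 𝕜, RdContinuous T B ∧ (∀ t ∈ T, ‖B t‖ ≤ δ) ∧
      (∀ t < 0, B t = 0) ∧ ¬ IsStable T (A + B) := by
  have hT' := hT.inter_Ici_zero
  -- The matrix `g x^* / ‖x‖²` maps `x` to `g` and has norm at most `‖g‖ / ‖x‖ ≤ δ`.
  set B₀ : ℝ → Matrix (Fin n) (Fin n) 𝕜 :=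
    fun t => (‖x t‖ ^ 2)⁻¹ • rankOneMatrix (g t) (x t) with hB₀
  have hxc : ContinuousOn x (T ∩ Set.Ici 0) := fun t ht => (hx t ht).continuousWithinAt hT' ht
  have hB₀rd : RdContinuous (T ∩ Set.Ici 0) B₀ := by
    refine RdContinuous.comp₂ (φ := fun (c : ℝ) (m : Matrix (Fin n) (Fin n) 𝕜) => c • m)
      continuous_smul (RdContinuous.of_continuousOn ?_)
      (RdContinuous.comp₂ (φ := rankOneMatrix) continuous_rankOneMatrix hg
        (RdContinuous.of_continuousOn hxc))
    exact (hxc.norm.pow 2).inv₀ fun t ht => pow_ne_zero 2 (norm_ne_zero_iff.2 (hx0 t ht))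
  have hB₀le : ∀ t ∈ T ∩ Set.Ici 0, ‖B₀ t‖ ≤ δ := by
    intro t ht
    have hpos : 0 < ‖x t‖ := norm_pos_iff.2 (hx0 t ht)
    rw [hB₀, norm_smul, Real.norm_of_nonneg (by positivity), inv_mul_le_iff₀ (by positivity)]
    refine (norm_rankOneMatrix_le _ _).trans ?_
    calc _ ≤ δ * ‖x t‖ * ‖x t‖ := by gcongr; exact hgx t ht
      _ = _ := by ring
  have hB₀x : ∀ t ∈ T ∩ Set.Ici 0, matrixAction (B₀ t) (x t) = g t := by
    intro t ht
    have hpos : 0 < ‖x t‖ := norm_pos_iff.2 (hx0 t ht)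
    rw [hB₀, map_smul, smul_apply, matrixAction_apply,
      toEuclideanLin_rankOneMatrix, inner_self_eq_norm_sq_to_K]
    have : (((‖x t‖ : ℝ) : 𝕜) ^ 2) • g t = (‖x t‖ ^ 2 : ℝ) • g t := by
      rw [← RCLike.ofReal_pow]
      ext i
      simp [RCLike.real_smul_eq_coe_mul]
    rw [this, smul_smul, inv_mul_cancel₀ (by positivity), one_smul]
  have hδ0 : 0 ≤ δ := (norm_nonneg _).trans (hB₀le 0 hT'.zero_mem)
  refine ⟨fun t => max 0 (min t 1) • B₀ t, hB₀rd.smul_cutoff hB₀le, fun t ht => ?_,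
    fun t ht => ?_, fun hst => ?_⟩
  · rw [norm_smul, Real.norm_of_nonneg (le_max_left _ _)]
    rcases le_or_gt t 0 with h | h
    · rwa [max_eq_left ((min_le_left _ _).trans h), zero_mul]
    · refine (mul_le_of_le_one_left (norm_nonneg _) ?_).trans (hB₀le t ⟨ht, h.le⟩)
      exact max_le zero_le_one (min_le_right _ _)
  · simp only [max_eq_left ((min_le_left t 1).trans ht.le), zero_smul]
  -- Beyond time `1` the ramp equals `1` and `x` solves the perturbed system. Stability at `t₀` is
  -- refuted by the multiple of `x` of norm `η / 2` at `t₀`.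
  · obtain ⟨t₀, ht₀, h1⟩ := hT.nonempty_gt 1
    have h0 : (0 : ℝ) ≤ t₀ := by linarith
    obtain ⟨η, hη, hst⟩ := hst t₀ ht₀ 1 one_pos
    have hn : 0 < ‖x t₀‖ := norm_pos_iff.2 (hx0 t₀ ⟨ht₀, h0⟩)
    set c : ℝ := η / (2 * ‖x t₀‖) with hc
    have hcpos : 0 < c := by positivity
    have hsol : IsSolutionFrom T (A + fun t => max 0 (min t 1) • B₀ t) t₀ (fun t => c • x t) := by
      intro t ht
      have htt : t₀ ≤ t := ht.2
      have ht0 : t ∈ T ∩ Set.Ici 0 := ⟨ht.1, h0.trans htt⟩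
      have hd := ((hx t ht0).clm_apply (c • ContinuousLinearMap.id ℝ _) hT' ht0).inter_Ici htt
      have hset : T ∩ Set.Ici 0 ∩ Set.Ici t₀ = T ∩ Set.Ici t₀ := by
        rw [Set.inter_assoc, Set.inter_eq_right.2 (Set.Ici_subset_Ici.2 h0)]
      rw [hset] at hd
      have hone : max 0 (min t 1) = 1 := by
        rw [min_eq_right (by linarith), max_eq_right zero_le_one]
      have e : Matrix.toEuclideanLin ((A + fun t => max 0 (min t 1) • B₀ t) t) (c • x t)
          = c • (matrixAction (A t) (x t) + g t) := by
        rw [← matrixAction_apply, Pi.add_apply, map_smul, map_add, add_apply]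
        simp only [hone, one_smul]
        rw [hB₀x t ht0]
      rw [e]
      exact hd
    obtain ⟨t, ht, htt, hCt⟩ := hub (1 / c) t₀
    have := hst _ hsol (by
      rw [norm_smul, Real.norm_of_nonneg hcpos.le, hc]
      field_simp
      linarith) t ⟨ht, htt⟩
    rw [norm_smul, Real.norm_of_nonneg hcpos.le] at this
    rw [div_lt_iff₀ hcpos] at hCt
    linarith

/-- Uniform regressivity persists under small perturbations supported where `μ` is bounded. -/
theorem IsUniformlyRegressive.add_small {T : Set ℝ} (hT : IsTimeScale T)
    {A B : ℝ → Matrix (Fin n) (Fin n) 𝕜} {K M δ : ℝ}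
    (hunit : ∀ t ∈ T, IsUnit (1 + mu T t • A t))
    (hK : ∀ t ∈ T, ‖(1 + mu T t • A t)⁻¹‖ ≤ K)
    (hM : ∀ t ∈ T, 0 ≤ t → mu T t ≤ M) (hB : ∀ t ∈ T, ‖B t‖ ≤ δ) (hneg : ∀ t < 0, B t = 0)
    (hsmall : K * (M * δ) ≤ 1 / 2) : IsUniformlyRegressive T (A + B) := by
  -- Factor out `1 + μ A` and treat `1 + W` as a Neumann perturbation of the identity. At negative
  -- times `μ` need not be bounded by `M`, but there `B = 0` and `W = 0`.
  have key : ∀ t ∈ T, ∃ W : Matrix (Fin n) (Fin n) 𝕜, ‖W‖ ≤ 1 / 2 ∧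
      1 + mu T t • (A + B) t = (1 + mu T t • A t) * (1 + W) := by
    intro t ht
    refine ⟨(1 + mu T t • A t)⁻¹ * (mu T t • B t), ?_, ?_⟩
    · rcases lt_or_ge t 0 with h | h
      · rw [hneg t h, smul_zero, mul_zero, norm_zero]
        norm_num
      · refine (norm_mul_le _ _).trans (le_trans ?_ hsmall)
        rw [norm_smul, Real.norm_of_nonneg (hT.mu_nonneg t)]
        have h1 := hM t ht h
        have h2 := hB t ht
        have h3 := hK t ht
        have h4 := hT.mu_nonneg t
        have h5 : 0 ≤ K := (norm_nonneg _).trans h3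
        have h6 : 0 ≤ M := h4.trans h1
        gcongr
    · have hdet := (Matrix.isUnit_iff_isUnit_det _).1 (hunit t ht)
      rw [mul_add, mul_one, ← mul_assoc, Matrix.mul_nonsing_inv _ hdet, one_mul, Pi.add_apply,
        smul_add, add_assoc]
  have hW : ∀ W : Matrix (Fin n) (Fin n) 𝕜, ‖W‖ ≤ 1 / 2 → IsUnit (1 + W) ∧ ‖(1 + W)⁻¹‖ ≤ 2 := by
    intro W hW
    have hu : IsUnit (1 + W) := by
      have := isUnit_one_sub_of_norm_lt_one (x := -W) (by rw [norm_neg]; linarith)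
      simpa using this
    refine ⟨hu, ?_⟩
    have hdet := (Matrix.isUnit_iff_isUnit_det _).1 hu
    have h1 : (1 + W)⁻¹ = 1 - W * (1 + W)⁻¹ := by
      have := Matrix.mul_nonsing_inv _ hdet
      rw [add_mul, one_mul] at this
      exact eq_sub_of_add_eq this
    have h2 : ‖(1 + W)⁻¹‖ ≤ 1 + 1 / 2 * ‖(1 + W)⁻¹‖ := by
      conv_lhs => rw [h1]
      refine (norm_sub_le _ _).trans (add_le_add l2_opNorm_one_le ((norm_mul_le _ _).trans ?_))
      gcongr
    linarith
  refine ⟨fun t ht => ?_, 2 * K, fun t ht => ?_⟩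
  · obtain ⟨W, h1, h2⟩ := key t ht
    rw [h2]
    exact (hunit t ht).mul (hW W h1).1
  · obtain ⟨W, h1, h2⟩ := key t ht
    rw [h2, Matrix.mul_inv_rev]
    refine (norm_mul_le _ _).trans (mul_le_mul (hW W h1).2 (hK t ht) (norm_nonneg _) zero_le_two)

end Perturbation

/-! ### Bounded graininess and the nodes -/

section Nodes

variable {T : Set ℝ} {L M : ℝ}

/-- The upper limit controls `μ` beyond some `b`. For `0 ≤ t < b`, a fixed point `q > b` of `T`
gives `μ(t) ≤ q - t ≤ q`. -/
theorem IsTimeScale.exists_mu_le (hT : IsTimeScale T) (hsyn : IsSyndetic T) :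
    ∃ M : ℝ, 0 < M ∧ ∀ t ∈ T, 0 ≤ t → mu T t ≤ M := by
  obtain ⟨c, hc1, hc2⟩ := EReal.lt_iff_exists_real_btwn.1 hsyn
  have hev := eventually_lt_of_limsup_lt hc1
  unfold atTopIn at hev
  rw [eventually_inf_principal, eventually_atTop] at hev
  obtain ⟨b, hb⟩ := hev
  obtain ⟨q, hq, hbq⟩ := hT.nonempty_gt (max b 0)
  refine ⟨max c q, lt_max_of_lt_right ((le_max_right _ _).trans_lt hbq), fun t ht h0 => ?_⟩
  rcases le_or_gt b t with h | h
  · exact le_max_of_le_left (EReal.coe_lt_coe_iff.1 (hb t h ht)).le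
  · have := sigma_le hq (h.trans ((le_max_left _ _).trans_lt hbq))
    refine le_max_of_le_right ?_
    rw [mu]
    linarith

/-- The first point of `T` not before `N L`. -/
noncomputable def node (T : Set ℝ) (L : ℝ) (N : ℕ) : ℝ := sInf (T ∩ Set.Ici (N * L))

theorem IsTimeScale.nonempty_inter_Ici (hT : IsTimeScale T) (a : ℝ) : (T ∩ Set.Ici a).Nonempty := by
  obtain ⟨s, hs, h⟩ := hT.nonempty_gt a
  exact ⟨s, hs, h.le⟩

theorem node_le_of_mem {t : ℝ} {N : ℕ} (ht : t ∈ T) (h : N * L ≤ t) : node T L N ≤ t :=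
  csInf_le ⟨N * L, fun _ hs => hs.2⟩ ⟨ht, h⟩

theorem IsTimeScale.le_node (hT : IsTimeScale T) (L : ℝ) (N : ℕ) : N * L ≤ node T L N :=
  le_csInf (hT.nonempty_inter_Ici _) fun _ hs => hs.2

theorem IsTimeScale.node_mem (hT : IsTimeScale T) (L : ℝ) (N : ℕ) : node T L N ∈ T :=
  ((hT.isClosed.inter isClosed_Ici).csInf_mem (hT.nonempty_inter_Ici _)
    ⟨N * L, fun _ hs => hs.2⟩).1

theorem IsTimeScale.node_le (hT : IsTimeScale T) (hL : 0 ≤ L)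
    (hM : ∀ t ∈ T, mu T t ≤ M) (N : ℕ) : node T L N ≤ N * L + M := by
  have hNL : 0 ≤ N * L := by positivity
  have hle := floorIn_le hT.zero_mem hNL
  have hm := hM _ (hT.floorIn_mem (N * L))
  rcases hle.eq_or_lt with h | h
  · have := node_le_of_mem (hT.floorIn_mem (N * L)) h.ge
    have := (hT.mu_nonneg 0).trans (hM 0 hT.zero_mem)
    linarith
  · have := node_le_of_mem (hT.sigma_mem _) (hT.lt_sigma_floorIn h).le
    rw [mu] at hm
    linarith

theorem IsTimeScale.node_mono (hT : IsTimeScale T) (hL : 0 ≤ L) {N N' : ℕ} (h : N ≤ N') :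
    node T L N ≤ node T L N' := by
  refine node_le_of_mem (hT.node_mem L N') (le_trans ?_ (hT.le_node L N'))
  gcongr

theorem exists_block (hL : 0 < L) {t : ℝ} (ht : 0 ≤ t) :
    ∃ N : ℕ, N * L ≤ t ∧ t < (N + 1) * L := by
  refine ⟨⌊t / L⌋₊, ?_, ?_⟩
  · exact (le_div_iff₀ hL).1 (Nat.floor_le (by positivity))
  · exact (div_lt_iff₀ hL).1 (Nat.lt_floor_add_one _)

end Nodes

/-! ### Consequences of a nonnegative central exponent -/

section UpperFunctions

variable {𝕜 : Type*} [RCLike 𝕜] {n : ℕ} {T : Set ℝ} {A X Y : ℝ → Matrix (Fin n) (Fin n) 𝕜} {K : ℝ}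

theorem isUpperFunction_expRate (hT : IsTimeScale T)
    (hX : IsFundamentalPair (T ∩ Set.Ici 0) A X Y K) {G : ℝ → ℝ} (hG : ContDiff ℝ 1 G) {C : ℝ}
    (hC : 0 < C) (hbound : ∀ s ∈ T ∩ Set.Ici 0, ∀ t ∈ T ∩ Set.Ici 0, s ≤ t →
      ‖X t * Y s‖ ≤ C * Real.exp (G t - G s)) :
    IsUpperFunction T A (expRate (T ∩ Set.Ici 0) G) := by
  have hT' := hT.inter_Ici_zero
  refine ⟨rdContinuous_expRate hT' hG, fun t ht => ?_, fun t s => X t * Y s, fun s hs => ?_,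
    C, hC, fun s hs t ht hst => ?_⟩
  · rw [← mu_inter_Ici T ht.2, one_add_mu_mul_expRate]
    exact Real.exp_pos _
  · refine ⟨hX.mul_inv s hs, fun t ht hst => ?_⟩
    have := ((hX.deriv t ht).clm_apply
      ((ContinuousLinearMap.mul ℝ (Matrix (Fin n) (Fin n) 𝕜)).flip (Y s)) hT' ht).inter_Ici hst
    simpa [mul_assoc] using this
  · rw [genExp, logGenExp_expRate hT' Set.inter_subset_right hG hs ht]
    exact hbound s hs t ht hst

/-- The upper limit of `(G t - G 0) / t` is at least the central exponent, hence nonnegative, so it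
exceeds `-κ` at arbitrarily late times. -/
theorem exists_lt_of_centralUpperExponent_nonneg (hT : IsTimeScale T)
    (hχ : 0 ≤ centralUpperExponent T A) {G : ℝ → ℝ} (hG : ContDiff ℝ 1 G)
    (hup : IsUpperFunction T A (expRate (T ∩ Set.Ici 0) G)) {κ : ℝ} (hκ : 0 < κ) (b : ℝ) :
    ∃ t ∈ T, b ≤ t ∧ 0 < t ∧ -κ * t < G t - G 0 := by
  have hT' := hT.inter_Ici_zero
  have h1 := hχ.trans (iInf₂_le _ hup)
  have h2 : ((-κ : ℝ) : EReal) < 0 := by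
    rw [← EReal.coe_zero, EReal.coe_lt_coe_iff]
    linarith
  have h3 := frequently_lt_of_lt_limsup (by isBoundedDefault) (h2.trans_le h1)
  unfold atTopIn at h3
  rw [frequently_inf_principal, frequently_atTop] at h3
  obtain ⟨t, hbt, htT, hlt⟩ := h3 (max b 1)
  have hpos : 0 < t := by linarith [(le_max_right b 1).trans hbt]
  refine ⟨t, htT, (le_max_left _ _).trans hbt, hpos, ?_⟩
  rw [EReal.coe_lt_coe_iff,
    logGenExp_expRate hT' Set.inter_subset_right hG hT'.zero_mem ⟨htT, hpos.le⟩,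
    one_div, ← div_eq_inv_mul, lt_div_iff₀ hpos] at hlt
  exact hlt

/-- In dimension zero all transition matrices vanish, so `e^{-t}` is already an upper bound and the
central exponent is negative. -/
theorem pos_of_centralUpperExponent_nonneg (hT : IsTimeScale T)
    (hX : IsFundamentalPair (T ∩ Set.Ici 0) A X Y K) (hχ : 0 ≤ centralUpperExponent T A) :
    n ≠ 0 := by
  rintro rfl
  have hG : ContDiff ℝ 1 fun t : ℝ => -t := contDiff_neg
  obtain ⟨t, -, -, hpos, hlt⟩ := exists_lt_of_centralUpperExponent_nonneg hT hχ hG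
    (isUpperFunction_expRate hT hX hG one_pos fun s _ t _ _ => by
      rw [Subsingleton.elim (X t * Y s) 0, norm_zero]
      positivity) one_half_pos 0
  linarith

end UpperFunctions

/-! ### Node transitions and the staircase upper function -/

section Blocks

variable {𝕜 : Type*} [RCLike 𝕜] {n : ℕ} {T : Set ℝ} {A X Y : ℝ → Matrix (Fin n) (Fin n) 𝕜}
  {K L M : ℝ}

/-- Transition matrix between consecutive nodes. -/
noncomputable def nodeTransition (T : Set ℝ) (L : ℝ) (X Y : ℝ → Matrix (Fin n) (Fin n) 𝕜) (N : ℕ) :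
    Matrix (Fin n) (Fin n) 𝕜 := X (node T L (N + 1)) * Y (node T L N)

theorem IsFundamentalPair.trans_mul (hX : IsFundamentalPair T A X Y K) (a b : ℝ) {c : ℝ}
    (hc : c ∈ T) : X a * Y c * (X c * Y b) = X a * Y b := by
  rw [mul_assoc, ← mul_assoc (Y c), hX.inv_mul c hc, one_mul]

variable [NeZero n]

theorem IsFundamentalPair.nodeTransition_pos (hT : IsTimeScale T)
    (hX : IsFundamentalPair T A X Y K) (N : ℕ) : 0 < ‖nodeTransition T L X Y N‖ := by
  rw [norm_pos_iff]
  intro h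
  have h1 : nodeTransition T L X Y N * (X (node T L N) * Y (node T L (N + 1))) = 1 := by
    rw [nodeTransition, hX.trans_mul _ _ (hT.node_mem L N), hX.mul_inv _ (hT.node_mem L _)]
  rw [h, zero_mul] at h1
  exact zero_ne_one h1

/-- Consecutive nodes are at most `L + M` apart. The forward estimate bounds the norm above; the
backward estimate for the inverse, with `1 ≤ ‖P‖ ‖P⁻¹‖`, bounds it below. -/
theorem IsFundamentalPair.abs_log_nodeTransition_le (hT : IsTimeScale T)
    (hL : 0 ≤ L) (hM : ∀ t ∈ T, mu T t ≤ M) (hK : 0 ≤ K)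
    (hX : IsFundamentalPair T A X Y K) (N : ℕ) :
    |Real.log ‖nodeTransition T L X Y N‖| ≤ K * (L + M) := by
  have hpos := hX.nodeTransition_pos hT (L := L) N
  have hm := hT.node_mono hL (Nat.le_succ N)
  have hlen : node T L (N + 1) - node T L N ≤ L + M := by
    have h1 := hT.node_le hL hM (N + 1)
    have h2 := hT.le_node L N
    push_cast at h1
    linarith
  have hexp : Real.exp (K * (node T L (N + 1) - node T L N)) ≤ Real.exp (K * (L + M)) := by
    gcongr
  have hf := (hX.norm_forward _ (hT.node_mem L N) _ (hT.node_mem L (N + 1)) hm).trans hexp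
  have hb := (hX.norm_backward _ (hT.node_mem L N) _ (hT.node_mem L (N + 1)) hm).trans hexp
  have h1 : nodeTransition T L X Y N * (X (node T L N) * Y (node T L (N + 1))) = 1 := by
    rw [nodeTransition, hX.trans_mul _ _ (hT.node_mem L N), hX.mul_inv _ (hT.node_mem L _)]
  have h2 : 1 ≤ ‖nodeTransition T L X Y N‖ * Real.exp (K * (L + M)) := by
    have := norm_mul_le (nodeTransition T L X Y N) (X (node T L N) * Y (node T L (N + 1)))
    rw [h1, norm_one] at this
    exact this.trans (mul_le_mul_of_nonneg_left hb hpos.le)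
  rw [abs_le]
  constructor
  · rw [Real.le_log_iff_exp_le hpos, Real.exp_neg, inv_le_iff_one_le_mul₀ (Real.exp_pos _)]
    exact h2
  · rw [Real.log_le_iff_le_exp hpos]
    exact hf

theorem IsFundamentalPair.norm_node_le (hT : IsTimeScale T) (hX : IsFundamentalPair T A X Y K)
    {i k : ℕ} (hik : i ≤ k) :
    ‖X (node T L k) * Y (node T L i)‖ ≤
      Real.exp (∑ j ∈ Finset.range k, Real.log ‖nodeTransition T L X Y j‖
        - ∑ j ∈ Finset.range i, Real.log ‖nodeTransition T L X Y j‖) := by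
  induction k, hik using Nat.le_induction with
  | base =>
    rw [hX.mul_inv _ (hT.node_mem L i), norm_one, sub_self, Real.exp_zero]
  | succ k _ ih =>
    rw [← hX.trans_mul _ _ (hT.node_mem L k), Finset.sum_range_succ, add_sub_right_comm,
      Real.exp_add, Real.exp_log (hX.nodeTransition_pos hT k), mul_comm (Real.exp _)]
    exact (norm_mul_le _ _).trans (mul_le_mul_of_nonneg_left ih (norm_nonneg _))

theorem abs_stepSum_sub_le (hM0 : 0 ≤ M) (hL : M + 2 ≤ L) {a : ℕ → ℝ} {c : ℝ}
    (ha : ∀ i, |a i| ≤ c) {N : ℕ} {t : ℝ} (h1 : N * L ≤ t) (h2 : t ≤ (N + 1) * L) :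
    |stepSum L M a t - ∑ i ∈ Finset.range N, a i| ≤ c := by
  rw [stepSum_block hM0 hL a (by linarith) (by linarith), add_sub_cancel_left, smul_eq_mul, abs_mul,
    abs_of_nonneg (Real.smoothTransition.nonneg _)]
  exact (mul_le_of_le_one_left (abs_nonneg _) (Real.smoothTransition.le_one _)).trans (ha N)

/-- The staircase through the logarithms of the norms of the node transitions bounds all
transition matrices. -/
theorem IsFundamentalPair.norm_le_exp_stepSum (hT : IsTimeScale T) (h0 : T ⊆ Set.Ici 0)
    (hM0 : 0 ≤ M) (hL : M + 2 ≤ L) (hM : ∀ t ∈ T, mu T t ≤ M) (hK : 0 ≤ K)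
    (hX : IsFundamentalPair T A X Y K) {s t : ℝ} (hs : s ∈ T) (ht : t ∈ T) (hst : s ≤ t) :
    ‖X t * Y s‖ ≤ Real.exp (2 * (K * L) + 2 * (K * (L + M))) *
      Real.exp (stepSum L M (fun j => Real.log ‖nodeTransition T L X Y j‖) t
        - stepSum L M (fun j => Real.log ‖nodeTransition T L X Y j‖) s) := by
  have hLpos : 0 < L := by linarith
  set a : ℕ → ℝ := fun j => Real.log ‖nodeTransition T L X Y j‖ with ha
  have hac : ∀ j, |a j| ≤ K * (L + M) := hX.abs_log_nodeTransition_le hT hLpos.le hM hK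
  obtain ⟨i, hi1, hi2⟩ := exists_block hLpos (h0 hs)
  obtain ⟨k, hk1, hk2⟩ := exists_block hLpos (h0 ht)
  have hik : i ≤ k := by
    have : (i : ℝ) * L < (k + 1) * L := by linarith
    have : (i : ℝ) < k + 1 := lt_of_mul_lt_mul_right this hLpos.le
    exact Nat.lt_succ_iff.1 (by exact_mod_cast this)
  have hns := node_le_of_mem hs hi1
  have hnt := node_le_of_mem ht hk1
  have hni := hT.le_node L i
  have hnk := hT.le_node L k
  -- Both nodes lie before their points, so the last piece on the right runs backward from `s` to
  -- node `i`. Each end piece costs `e^{K L}`, and replacing partial sums by staircase values costs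
  -- `K (L + M)` at each end.
  have e : X t * Y s = X t * Y (node T L k) *
      (X (node T L k) * Y (node T L i) * (X (node T L i) * Y s)) := by
    rw [hX.trans_mul _ _ (hT.node_mem L i), hX.trans_mul _ _ (hT.node_mem L k)]
  have hA1 : ‖X t * Y (node T L k)‖ ≤ Real.exp (K * L) :=
    (hX.norm_forward _ (hT.node_mem L k) _ ht hnt).trans (Real.exp_le_exp.2
      (mul_le_mul_of_nonneg_left (by linarith) hK))
  have hA2 : ‖X (node T L i) * Y s‖ ≤ Real.exp (K * L) :=
    (hX.norm_backward _ (hT.node_mem L i) _ hs hns).trans (Real.exp_le_exp.2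
      (mul_le_mul_of_nonneg_left (by linarith) hK))
  have hA3 := hX.norm_node_le hT (L := L) hik
  have hGt := abs_le.1 (abs_stepSum_sub_le hM0 hL hac hk1 hk2.le)
  have hGs := abs_le.1 (abs_stepSum_sub_le hM0 hL hac hi1 hi2.le)
  rw [e]
  calc _ ≤ Real.exp (K * L) * (Real.exp (∑ j ∈ Finset.range k, a j - ∑ j ∈ Finset.range i, a j)
        * Real.exp (K * L)) := by
        refine (norm_mul_le _ _).trans (mul_le_mul hA1 ((norm_mul_le _ _).trans
          (mul_le_mul hA3 hA2 (norm_nonneg _) (Real.exp_pos _).le)) (norm_nonneg _)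
          (Real.exp_pos _).le)
    _ ≤ _ := by
        rw [← Real.exp_add, ← Real.exp_add, ← Real.exp_add, Real.exp_le_exp]
        linarith [hGt.1, hGs.2]

end Blocks

/-! ### Bounds on difference quotients -/

section Slopes

/-- With `b = σ(a)` this bounds the Δ-derivative at dense and scattered points together: the local
hypothesis serves `b = a`, the other one `b ≠ a`. -/
theorem norm_dslope_le {E : Type*} [NormedAddCommGroup E] [NormedSpace ℝ E] {f : ℝ → E}
    {a b C : ℝ} (hC : 0 ≤ C) (h : ∀ᶠ s in 𝓝 a, ‖f s - f a‖ ≤ C * |s - a|)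
    (hb : ‖f b - f a‖ ≤ C * |b - a|) : ‖dslope f a b‖ ≤ C := by
  by_cases hab : b = a
  · rw [hab, dslope_same]
    exact norm_deriv_le_of_lip' hC h
  · have hpos : 0 < |b - a| := abs_pos.2 (sub_ne_zero.2 hab)
    rw [dslope_of_ne _ hab, slope_def_module, norm_smul, norm_inv, Real.norm_eq_abs,
      inv_mul_le_iff₀ hpos, mul_comm]
    exact hb

theorem abs_exp_sub_exp_le {η M t s : ℝ} (hη : 0 ≤ η) (hM : 0 ≤ M) (hs : s ≤ t + M) :
    |Real.exp (η * s) - Real.exp (η * t)| ≤ η * Real.exp (η * M) * Real.exp (η * t) * |s - t| := by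
  have key : ∀ p q : ℝ, p ≤ q → Real.exp (η * q) - Real.exp (η * p)
      ≤ η * Real.exp (η * q) * (q - p) := by
    intro p q _
    have h1 := Real.add_one_le_exp (-(η * (q - p)))
    have h2 : Real.exp (η * p) = Real.exp (η * q) * Real.exp (-(η * (q - p))) := by
      rw [← Real.exp_add]
      congr 1
      ring
    rw [h2]
    nlinarith [Real.exp_pos (η * q)]
  have hle : ∀ q, q ≤ t + M → Real.exp (η * q) ≤ Real.exp (η * M) * Real.exp (η * t) := by
    intro q hq
    rw [← Real.exp_add, Real.exp_le_exp]
    nlinarith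
  rcases le_total t s with h | h
  · rw [abs_of_nonneg (sub_nonneg.2 (Real.exp_le_exp.2 (by gcongr))),
      abs_of_nonneg (sub_nonneg.2 h)]
    refine (key t s h).trans ?_
    refine mul_le_mul_of_nonneg_right ?_ (sub_nonneg.2 h)
    rw [mul_assoc]
    exact mul_le_mul_of_nonneg_left (hle s hs) hη
  · rw [abs_sub_comm, abs_sub_comm s, abs_of_nonneg (sub_nonneg.2 (Real.exp_le_exp.2 (by gcongr))),
      abs_of_nonneg (sub_nonneg.2 h)]
    refine (key s t h).trans ?_
    refine mul_le_mul_of_nonneg_right ?_ (sub_nonneg.2 h)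
    rw [mul_assoc]
    exact mul_le_mul_of_nonneg_left (hle t (by linarith)) hη

theorem abs_dslope_exp_sigma_le {T : Set ℝ} (hT : IsTimeScale T) {η M t : ℝ} (hη : 0 ≤ η)
    (hM : 0 < M) (ht : mu T t ≤ M) :
    |dslope (fun s => Real.exp (η * s)) t (sigma T t)|
      ≤ η * Real.exp (η * M) * Real.exp (η * t) := by
  have := hT.le_sigma t
  refine norm_dslope_le (f := fun s => Real.exp (η * s)) (by positivity) ?_ ?_
  · filter_upwards [gt_mem_nhds (show t < t + M by linarith)] with s hs
    exact abs_exp_sub_exp_le hη hM.le hs.le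
  · refine abs_exp_sub_exp_le hη hM.le ?_
    rw [mu] at ht
    linarith

end Slopes

/-! ### Displacements at the nodes and the smooth path through them -/

section KickedPath

theorem exists_seq_of_forall_exists {α : Type*} {P : ℕ → α → α → Prop}
    (h : ∀ N a, ∃ b, P N a b) (a₀ : α) : ∃ u : ℕ → α, u 0 = a₀ ∧ ∀ N, P N (u N) (u (N + 1)) := by
  choose f hf using h
  exact ⟨fun N => Nat.rec a₀ f N, rfl, fun N => hf N _⟩

variable {𝕜 : Type*} [RCLike 𝕜] {n : ℕ} {T : Set ℝ} {A X Y : ℝ → Matrix (Fin n) (Fin n) 𝕜}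
  {K L M : ℝ}

theorem IsFundamentalPair.action_inv_action (hX : IsFundamentalPair T A X Y K) (a : ℝ) {b : ℝ}
    (hb : b ∈ T) (v : EuclideanSpace 𝕜 (Fin n)) :
    matrixAction (X a * Y b) (matrixAction (X b) v) = matrixAction (X a) v := by
  rw [← matrixAction_mul, mul_assoc, hX.inv_mul b hb, mul_one]

/-- In the coordinates `x = X z`, unperturbed solutions have constant `z`. A displacement `w` of `x`
at node `N` is the change `Y w` of `z`, and `w` is the one that `exists_kick` provides for the
transition to the next node. -/
theorem IsFundamentalPair.exists_kicked_sequence (hT : IsTimeScale T)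
    (hX : IsFundamentalPair T A X Y K) {ε : ℝ} (hε : 0 ≤ ε) (z₀ : EuclideanSpace 𝕜 (Fin n)) :
    ∃ z : ℕ → EuclideanSpace 𝕜 (Fin n), z 0 = z₀ ∧ ∀ N,
      ‖matrixAction (X (node T L N)) (z (N + 1) - z N)‖ ≤
        ε * ‖matrixAction (X (node T L N)) (z N)‖ ∧
      ε / 2 * ‖nodeTransition T L X Y N‖ * ‖matrixAction (X (node T L N)) (z N)‖ ≤
        ‖matrixAction (X (node T L (N + 1))) (z (N + 1))‖ := by
  have step : ∀ (N : ℕ) (z : EuclideanSpace 𝕜 (Fin n)), ∃ z' : EuclideanSpace 𝕜 (Fin n),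
      ‖matrixAction (X (node T L N)) (z' - z)‖ ≤ ε * ‖matrixAction (X (node T L N)) z‖ ∧
      ε / 2 * ‖nodeTransition T L X Y N‖ * ‖matrixAction (X (node T L N)) z‖ ≤
        ‖matrixAction (X (node T L (N + 1))) z'‖ := by
    intro N z
    obtain ⟨w, hw1, hw2⟩ := exists_kick (nodeTransition T L X Y N)
      (matrixAction (X (node T L N)) z) hε
    have hN := hT.node_mem L N
    have e : matrixAction (X (node T L N)) (matrixAction (Y (node T L N)) w) = w := by
      rw [← matrixAction_mul, hX.mul_inv _ hN, matrixAction_one]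
    refine ⟨z + matrixAction (Y (node T L N)) w, ?_, ?_⟩
    · rw [add_sub_cancel_left, e]
      exact hw1
    · refine hw2.trans (le_of_eq ?_)
      rw [← hX.action_inv_action (node T L (N + 1)) hN, map_add (matrixAction (X (node T L N))), e,
        nodeTransition]
  exact exists_seq_of_forall_exists step z₀

/-- Each block multiplies the norm by at least `ε / 2` times the norm of its transition matrix; the
loss `log (2 / ε)` does not depend on `L`. -/
theorem kicked_sequence_growth [NeZero n] (hT : IsTimeScale T) (hX : IsFundamentalPair T A X Y K)
    {ε : ℝ} (hε : 0 < ε) {z : ℕ → EuclideanSpace 𝕜 (Fin n)}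
    (hz : ∀ N, ε / 2 * ‖nodeTransition T L X Y N‖ * ‖matrixAction (X (node T L N)) (z N)‖ ≤
        ‖matrixAction (X (node T L (N + 1))) (z (N + 1))‖) (N : ℕ) :
    Real.exp (∑ j ∈ Finset.range N, Real.log ‖nodeTransition T L X Y j‖ - N * Real.log (2 / ε))
      * ‖matrixAction (X (node T L 0)) (z 0)‖ ≤ ‖matrixAction (X (node T L N)) (z N)‖ := by
  induction N with
  | zero => simp
  | succ N ih =>
    refine le_trans (le_of_eq ?_) ((mul_le_mul_of_nonneg_left ih (by positivity)).trans (hz N))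
    have e : ∑ j ∈ Finset.range (N + 1), Real.log ‖nodeTransition T L X Y j‖
        - ((N + 1 : ℕ) : ℝ) * Real.log (2 / ε)
        = -Real.log (2 / ε) + Real.log ‖nodeTransition T L X Y N‖ +
          (∑ j ∈ Finset.range N, Real.log ‖nodeTransition T L X Y j‖ - N * Real.log (2 / ε)) := by
      rw [Finset.sum_range_succ]
      push_cast
      ring
    rw [e, Real.exp_add, Real.exp_add, Real.exp_log (hX.nodeTransition_pos hT N), Real.exp_neg,
      Real.exp_log (by positivity), inv_div, mul_assoc _ (Real.exp _)]

/-- The smooth path that runs through the points of a sequence, one step in each block. -/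
noncomputable def stepPath (L M : ℝ) (z : ℕ → EuclideanSpace 𝕜 (Fin n)) (t : ℝ) :
    EuclideanSpace 𝕜 (Fin n) :=
  z 0 + stepSum L M (fun i => z (i + 1) - z i) t

theorem stepPath_block (hM : 0 ≤ M) (hL : M + 2 ≤ L) (z : ℕ → EuclideanSpace 𝕜 (Fin n)) {N : ℕ}
    {t : ℝ} (h1 : N * L - 1 ≤ t) (h2 : t ≤ (N + 1) * L + M) :
    stepPath L M z t = z N + Real.smoothTransition (t - N * L - M) • (z (N + 1) - z N) := by
  rw [stepPath, stepSum_block hM hL _ h1 h2, Finset.sum_range_sub]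
  abel

theorem contDiff_stepPath (hM : 0 ≤ M) (hL : 0 < L) (z : ℕ → EuclideanSpace 𝕜 (Fin n)) :
    ContDiff ℝ 1 (stepPath L M z) :=
  contDiff_const.add (contDiff_stepSum hM hL _)

theorem half_norm_le_norm_stepPath (hM : 0 ≤ M) (hL : M + 2 ≤ L)
    {z : ℕ → EuclideanSpace 𝕜 (Fin n)} {B : Matrix (Fin n) (Fin n) 𝕜} {N : ℕ} {ε : ℝ}
    (hε : ε ≤ 1 / 2)
    (hz : ‖matrixAction B (z (N + 1) - z N)‖ ≤ ε * ‖matrixAction B (z N)‖)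
    {t : ℝ} (h1 : N * L - 1 ≤ t) (h2 : t ≤ (N + 1) * L + M) :
    ‖matrixAction B (z N)‖ ≤ 2 * ‖matrixAction B (stepPath L M z t)‖ := by
  rw [stepPath_block hM hL z h1 h2, map_add, map_smul]
  set r := Real.smoothTransition (t - N * L - M)
  set y := matrixAction B (z N)
  set w := matrixAction B (z (N + 1) - z N)
  have hr : ‖r • w‖ ≤ 1 / 2 * ‖y‖ := by
    rw [norm_smul, Real.norm_of_nonneg (Real.smoothTransition.nonneg _)]
    refine (mul_le_of_le_one_left (norm_nonneg _) (Real.smoothTransition.le_one _)).trans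
      (hz.trans ?_)
    gcongr
  have h3 : ‖y‖ ≤ ‖y + r • w‖ + ‖r • w‖ := by
    have := norm_sub_le (y + r • w) (r • w)
    rwa [add_sub_cancel_right] at this
  linarith

/-- The relative speed of the path, seen through the fundamental solution, is of the order of the
relative size `ε` of the displacements. -/
theorem IsFundamentalPair.norm_dslope_stepPath_le (hT : IsTimeScale T)
    (hM0 : 0 ≤ M) (hL : M + 2 ≤ L) (hM : ∀ t ∈ T, mu T t ≤ M) (hK : 0 ≤ K)
    (hX : IsFundamentalPair T A X Y K) {ε D : ℝ} (hε0 : 0 ≤ ε) (hε : ε ≤ 1 / 2) (hD0 : 0 ≤ D)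
    (hD : ∀ a b, |Real.smoothTransition a - Real.smoothTransition b| ≤ D * |a - b|)
    {z : ℕ → EuclideanSpace 𝕜 (Fin n)} {N : ℕ}
    (hz : ‖matrixAction (X (node T L N)) (z (N + 1) - z N)‖ ≤
        ε * ‖matrixAction (X (node T L N)) (z N)‖) {t : ℝ} (ht : t ∈ T) (h1 : N * L ≤ t)
    (h2 : t < (N + 1) * L) :
    ‖matrixAction (X t) (dslope (stepPath L M z) t (sigma T t))‖ ≤
      2 * D * ε * Real.exp (2 * (K * (M + 1))) * ‖matrixAction (X t) (stepPath L M z t)‖ := by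
  have hLpos : 0 < L := by linarith
  have hσ := hT.le_sigma t
  have hσM : sigma T t ≤ t + M := by
    have := hM t ht
    rw [mu] at this
    linarith
  have hdiff : DifferentiableAt ℝ (stepPath L M z) t :=
    (contDiff_stepPath hM0 hLpos z).differentiable (by simp) t
  rw [← ContinuousLinearMap.dslope_comp _ _ _ _ fun _ => hdiff]
  have hdelta : ∀ s, N * L - 1 ≤ s → s ≤ (N + 1) * L + M →
      matrixAction (X t) (stepPath L M z s) - matrixAction (X t) (stepPath L M z t)
        = (Real.smoothTransition (s - N * L - M) - Real.smoothTransition (t - N * L - M)) •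
          matrixAction (X t) (z (N + 1) - z N) := by
    intro s hs1 hs2
    rw [← map_sub, ← map_smul, stepPath_block hM0 hL z hs1 hs2,
      stepPath_block hM0 hL z (by linarith : N * L - 1 ≤ t) (by linarith)]
    congr 1
    module
  have hnear : ∀ᶠ s in 𝓝 t, N * L - 1 ≤ s ∧ s ≤ (N + 1) * L + M := by
    filter_upwards [lt_mem_nhds (show N * L - 1 < t by linarith),
      gt_mem_nhds (show t < (N + 1) * L + M by linarith)] with s h3 h4
    exact ⟨h3.le, h4.le⟩
  have hC : 0 ≤ 2 * D * ε * Real.exp (2 * (K * (M + 1))) *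
      ‖matrixAction (X t) (stepPath L M z t)‖ := by positivity
  -- Late in the block the jump is over and the path is constant up to and including `σ(t)`.
  -- Otherwise `t` is within `M + 1` of the node, so carrying the estimate at the node to `t` costs
  -- only `e^{2 K (M + 1)}`, with no `L` in it.
  rcases lt_or_ge (N * L + M + 1) t with hlate | hearly
  · have hzero : ∀ s, N * L + M + 1 ≤ s → s ≤ (N + 1) * L + M →
        matrixAction (X t) (stepPath L M z s) - matrixAction (X t) (stepPath L M z t) = 0 := by
      intro s hs1 hs2
      rw [hdelta s (by linarith) hs2, Real.smoothTransition.one_of_one_le (by linarith),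
        Real.smoothTransition.one_of_one_le (by linarith), sub_self, zero_smul]
    refine norm_dslope_le hC ?_ ?_
    · filter_upwards [hnear, lt_mem_nhds hlate] with s hs hs2
      simp only [Function.comp_apply]
      rw [hzero s hs2.le hs.2, norm_zero]
      positivity
    · simp only [Function.comp_apply]
      rw [hzero _ (by linarith) (by linarith), norm_zero]
      positivity
  · have hnode := hT.node_mem L N
    have hnt := node_le_of_mem ht h1
    have hlen : t - node T L N ≤ M + 1 := by linarith [hT.le_node L N]
    have hexp : Real.exp (K * (t - node T L N)) ≤ Real.exp (K * (M + 1)) := by gcongr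
    have hv : ‖matrixAction (X t) (z (N + 1) - z N)‖ ≤
        2 * ε * Real.exp (2 * (K * (M + 1))) * ‖matrixAction (X t) (stepPath L M z t)‖ := by
      have hy := half_norm_le_norm_stepPath hM0 hL hε hz (by linarith : N * L - 1 ≤ t)
        (by linarith)
      have hf := (hX.norm_forward _ hnode _ ht hnt).trans hexp
      have hb := (hX.norm_backward _ hnode _ ht hnt).trans hexp
      have hb' : ‖matrixAction (X (node T L N)) (stepPath L M z t)‖
          ≤ Real.exp (K * (M + 1)) * ‖matrixAction (X t) (stepPath L M z t)‖ := by
        rw [← hX.action_inv_action (node T L N) ht]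
        exact (norm_matrixAction_le _ _).trans (mul_le_mul_of_nonneg_right hb (norm_nonneg _))
      rw [← hX.action_inv_action t hnode (z (N + 1) - z N)]
      refine (norm_matrixAction_le _ _).trans ?_
      calc _ ≤ Real.exp (K * (M + 1)) * (ε * (2 * (Real.exp (K * (M + 1)) *
            ‖matrixAction (X t) (stepPath L M z t)‖))) := by
            refine mul_le_mul hf (hz.trans ?_) (norm_nonneg _) (Real.exp_pos _).le
            exact mul_le_mul_of_nonneg_left (hy.trans (by linarith)) hε0
        _ = _ := by
            rw [two_mul (K * (M + 1)), Real.exp_add]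
            ring
    have hbound : ∀ s, N * L - 1 ≤ s → s ≤ (N + 1) * L + M →
        ‖matrixAction (X t) (stepPath L M z s) - matrixAction (X t) (stepPath L M z t)‖
          ≤ 2 * D * ε * Real.exp (2 * (K * (M + 1))) *
            ‖matrixAction (X t) (stepPath L M z t)‖ * |s - t| := by
      intro s hs1 hs2
      rw [hdelta s hs1 hs2, norm_smul, Real.norm_eq_abs]
      have h5 := hD (s - N * L - M) (t - N * L - M)
      have e5 : s - N * L - M - (t - N * L - M) = s - t := by ring
      rw [e5] at h5
      calc _ ≤ (D * |s - t|) * (2 * ε * Real.exp (2 * (K * (M + 1))) *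
            ‖matrixAction (X t) (stepPath L M z t)‖) :=
            mul_le_mul h5 hv (norm_nonneg _) (by positivity)
        _ = _ := by ring
    refine norm_dslope_le hC ?_ ?_
    · filter_upwards [hnear] with s hs using hbound s hs.1 hs.2
    · exact hbound _ (by linarith) (by linarith)

end KickedPath

/-! ### The unbounded solution of a perturbed equation -/

section GrowingSolution

variable {𝕜 : Type*} [RCLike 𝕜] {n : ℕ} {T : Set ℝ} {A X Y : ℝ → Matrix (Fin n) (Fin n) 𝕜}
  {K L M η : ℝ}

/-- The function `e^{η t} X(t) z(t)`. -/
noncomputable def boostedPath (η : ℝ) (X : ℝ → Matrix (Fin n) (Fin n) 𝕜)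
    (z : ℝ → EuclideanSpace 𝕜 (Fin n)) (t : ℝ) : EuclideanSpace 𝕜 (Fin n) :=
  Real.exp (η * t) • matrixAction (X t) (z t)

/-- The part of the Δ-derivative of `e^{η t} X(t) z(t)` due to the variation of `e^{η t} z(t)`,
divided by `E + μ A`. -/
noncomputable def boostedRate (T : Set ℝ) (η : ℝ) (X : ℝ → Matrix (Fin n) (Fin n) 𝕜)
    (z : ℝ → EuclideanSpace 𝕜 (Fin n)) (t : ℝ) : EuclideanSpace 𝕜 (Fin n) :=
  dslope (fun s => Real.exp (η * s)) t (sigma T t) • matrixAction (X t) (z t) +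
    (Real.exp (η * t) * Real.exp (η * mu T t)) • matrixAction (X t) (dslope z t (sigma T t))

theorem contDiff_exp_mul (η : ℝ) : ContDiff ℝ 1 fun s : ℝ => Real.exp (η * s) := by fun_prop

/-- Variation of constants: for `v = e^{η t} z`, the Leibniz rule with `X(σ(t)) = (1 + μ A) X` gives
`(X v)^Δ = A X v + (1 + μ A) X v^Δ`, and `boostedRate` is `X v^Δ`. -/
theorem hasDeltaDerivAt_boostedPath (hT : IsTimeScale T) (hX : IsFundamentalPair T A X Y K)
    {z : ℝ → EuclideanSpace 𝕜 (Fin n)} (hz : ContDiff ℝ 1 z) {t : ℝ} (ht : t ∈ T) :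
    HasDeltaDerivAt T (boostedPath η X z)
      (matrixAction (A t) (boostedPath η X z t) +
        (boostedRate T η X z t + mu T t • matrixAction (A t) (boostedRate T η X z t))) t := by
  have hp := (hX.deriv t ht).bilinear matrixAction hT ht (hasDeltaDerivAt_of_contDiff hz hT ht)
  have he := hasDeltaDerivAt_of_contDiff (contDiff_exp_mul η) hT ht
  have hx := he.bilinear (ContinuousLinearMap.lsmul ℝ ℝ) hT ht hp
  have heσ := he.apply_sigma hT ht
  rw [(hX.deriv t ht).apply_sigma hT ht] at hx
  have hσ : Real.exp (η * t) * Real.exp (η * mu T t) = Real.exp (η * sigma T t) := by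
    rw [← Real.exp_add, sigma_eq]
    congr 1
    ring
  simp only [smul_eq_mul] at heσ
  simp only [ContinuousLinearMap.lsmul_apply, map_add, map_smul, add_apply, smul_apply,
    matrixAction_mul, heσ] at hx
  unfold boostedPath boostedRate
  rw [hσ]
  simp only [map_add, map_smul, heσ]
  refine hx.congr_deriv ?_
  module

theorem rdContinuous_boostedRate (hT : IsTimeScale T) (hX : IsFundamentalPair T A X Y K)
    {z : ℝ → EuclideanSpace 𝕜 (Fin n)} (hz : ContDiff ℝ 1 z) :
    RdContinuous T (boostedRate T η X z) := by
  have hXc : RdContinuous T X :=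
    RdContinuous.of_continuousOn fun t ht => (hX.deriv t ht).continuousWithinAt hT ht
  have hsm : Continuous fun p : ℝ × EuclideanSpace 𝕜 (Fin n) => p.1 • p.2 := continuous_smul
  refine RdContinuous.comp₂ (φ := fun a b : EuclideanSpace 𝕜 (Fin n) => a + b) continuous_add
    (RdContinuous.comp₂ (φ := fun (c : ℝ) (v : EuclideanSpace 𝕜 (Fin n)) => c • v) hsm
      (rdContinuous_dslope_sigma (contDiff_exp_mul η) hT)
      (RdContinuous.comp₂ (φ := fun B v => matrixAction B v) continuous_matrixAction hXc
        (RdContinuous.of_continuousOn hz.continuous.continuousOn)))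
    (RdContinuous.comp₂ (φ := fun (c : ℝ) (v : EuclideanSpace 𝕜 (Fin n)) => c • v) hsm
      (RdContinuous.comp₂ (φ := fun a b : ℝ => a * b) continuous_mul
        (RdContinuous.of_continuousOn (contDiff_exp_mul η).continuous.continuousOn)
        (hT.rdContinuous_mu.comp (φ := fun m => Real.exp (η * m)) (by fun_prop)))
      (RdContinuous.comp₂ (φ := fun B v => matrixAction B v) continuous_matrixAction hXc
        (rdContinuous_dslope_sigma hz hT)))

theorem norm_boostedRate_le (hT : IsTimeScale T) (hη : 0 ≤ η) (hM0 : 0 < M) {t : ℝ}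
    (hM : mu T t ≤ M) {z : ℝ → EuclideanSpace 𝕜 (Fin n)} {δ : ℝ}
    (hz : ‖matrixAction (X t) (dslope z t (sigma T t))‖ ≤ δ * ‖matrixAction (X t) (z t)‖) :
    ‖boostedRate T η X z t‖ ≤ Real.exp (η * M) * (η + δ) * ‖boostedPath η X z t‖ := by
  have h1 := abs_dslope_exp_sigma_le hT hη hM0 hM
  have h2 : Real.exp (η * mu T t) ≤ Real.exp (η * M) := by gcongr
  unfold boostedRate boostedPath
  refine (norm_add_le _ _).trans ?_
  rw [norm_smul, norm_smul, norm_smul, Real.norm_of_nonneg (Real.exp_pos (η * t)).le,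
    Real.norm_of_nonneg (by positivity : 0 ≤ Real.exp (η * t) * Real.exp (η * mu T t)),
    Real.norm_eq_abs]
  calc _ ≤ (η * Real.exp (η * M) * Real.exp (η * t)) * ‖matrixAction (X t) (z t)‖ +
        Real.exp (η * t) * Real.exp (η * M) * (δ * ‖matrixAction (X t) (z t)‖) :=
        add_le_add (mul_le_mul_of_nonneg_right h1 (norm_nonneg _))
          (mul_le_mul (mul_le_mul_of_nonneg_left h2 (Real.exp_pos _).le) hz (norm_nonneg _)
            (by positivity))
    _ = _ := by ring

theorem norm_add_mu_smul_action_le (hT : IsTimeScale T) {t : ℝ} (hM : mu T t ≤ M)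
    (hA : ‖A t‖ ≤ K) (v : EuclideanSpace 𝕜 (Fin n)) :
    ‖v + mu T t • matrixAction (A t) v‖ ≤ (1 + M * K) * ‖v‖ := by
  have hμ := hT.mu_nonneg t
  refine (norm_add_le _ _).trans ?_
  rw [norm_smul, Real.norm_of_nonneg hμ, add_mul, one_mul, mul_assoc]
  have : ‖matrixAction (A t) v‖ ≤ K * ‖v‖ :=
    (norm_matrixAction_le _ _).trans (mul_le_mul_of_nonneg_right hA (norm_nonneg _))
  have h0 : 0 ≤ M := hμ.trans hM
  gcongr

/-- If the staircase of the logarithms of the norms of the node transitions does not decay at a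
definite rate, the equation has an unbounded solution after an arbitrarily small relative
perturbation. -/
theorem exists_unbounded_perturbed_solution [NeZero n] (hT : IsTimeScale T) (h0 : T ⊆ Set.Ici 0)
    (hM0 : 0 < M) (hM : ∀ t ∈ T, mu T t ≤ M) (hK : 0 < K) (hAK : ∀ t ∈ T, ‖A t‖ ≤ K)
    (hA : RdContinuous T A) (hX : IsFundamentalPair T A X Y K)
    (hfreq : ∀ L, M + 2 ≤ L → ∀ κ > 0, ∀ b : ℝ, ∃ t ∈ T, b ≤ t ∧
      -κ * t < stepSum L M (fun j => Real.log ‖nodeTransition T L X Y j‖) t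
        - stepSum L M (fun j => Real.log ‖nodeTransition T L X Y j‖) 0)
    {δ : ℝ} (hδ : 0 < δ) :
    ∃ x g : ℝ → EuclideanSpace 𝕜 (Fin n),
      (∀ t ∈ T, HasDeltaDerivAt T x (matrixAction (A t) (x t) + g t) t) ∧
      (∀ t ∈ T, x t ≠ 0) ∧ RdContinuous T g ∧ (∀ t ∈ T, ‖g t‖ ≤ δ * ‖x t‖) ∧
      ∀ C b : ℝ, ∃ t ∈ T, b ≤ t ∧ C < ‖x t‖ := by
  obtain ⟨D, hD0, hD⟩ := exists_lipschitz_smoothTransition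
  -- `c₀` covers the factors `1 + μ A` and `e^{η M} ≤ e^M`. Half of `δ` is spent on `e^{η t}`, half
  -- on the displacements; neither `η` nor `ε` depends on `L`.
  set c₀ : ℝ := (1 + M * K) * Real.exp M with hc₀
  have hc₀pos : 0 < c₀ := by positivity
  obtain ⟨η, hη0, hη1, hηδ⟩ : ∃ η : ℝ, 0 < η ∧ η ≤ 1 ∧ c₀ * η ≤ δ / 2 := by
    refine ⟨min 1 (δ / (2 * c₀)), by positivity, min_le_left _ _, ?_⟩
    calc _ ≤ c₀ * (δ / (2 * c₀)) := by gcongr; exact min_le_right _ _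
      _ = δ / 2 := by field_simp
  set c₁ : ℝ := 2 * D * Real.exp (2 * (K * (M + 1))) with hc₁
  have hc₁pos : 0 < c₁ := by positivity
  obtain ⟨ε, hε0, hε1, hεδ⟩ : ∃ ε : ℝ, 0 < ε ∧ ε ≤ 1 / 2 ∧ c₀ * (c₁ * ε) ≤ δ / 2 := by
    refine ⟨min (1 / 2) (δ / (2 * c₀ * c₁)), by positivity, min_le_left _ _, ?_⟩
    calc _ ≤ c₀ * (c₁ * (δ / (2 * c₀ * c₁))) := by gcongr; exact min_le_right _ _
      _ = δ / 2 := by field_simp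
  -- Blocks so long that the loss `log (2 / ε)` per block is at most a third of the gain `η L`.
  obtain ⟨L, hL, hLη⟩ : ∃ L : ℝ, M + 2 ≤ L ∧ 3 * Real.log (2 / ε) ≤ η * L := by
    refine ⟨max (M + 2) (3 * Real.log (2 / ε) / η), le_max_left _ _, ?_⟩
    rw [mul_comm η, ← div_le_iff₀ hη0]
    exact le_max_right _ _
  have hLpos : 0 < L := by linarith
  obtain ⟨z₀, hz₀⟩ := exists_ne (0 : EuclideanSpace 𝕜 (Fin n))
  obtain ⟨z, hz0, hz⟩ := hX.exists_kicked_sequence hT (L := L) hε0.le z₀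
  have hinj : ∀ t ∈ T, ∀ v : EuclideanSpace 𝕜 (Fin n), v ≠ 0 → matrixAction (X t) v ≠ 0 := by
    intro t ht v hv h
    apply hv
    rw [← matrixAction_one (𝕜 := 𝕜) v, ← hX.inv_mul t ht, matrixAction_mul, h, map_zero]
  have hgrow := kicked_sequence_growth hT hX hε0 (fun N => (hz N).2)
  have hy0 : 0 < ‖matrixAction (X (node T L 0)) (z 0)‖ :=
    norm_pos_iff.2 (hinj _ (hT.node_mem L 0) _ (hz0 ▸ hz₀))
  have hyN : ∀ N, 0 < ‖matrixAction (X (node T L N)) (z N)‖ := fun N =>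
    lt_of_lt_of_le (by positivity) (hgrow N)
  set p := stepPath L M z with hp
  have hpc : ContDiff ℝ 1 p := contDiff_stepPath hM0.le hLpos z
  have hpne : ∀ t ∈ T, p t ≠ 0 := by
    intro t ht hpt
    obtain ⟨N, h1, h2⟩ := exists_block hLpos (h0 ht)
    have := half_norm_le_norm_stepPath hM0.le hL hε1 (hz N).1 (by linarith : N * L - 1 ≤ t)
      (by linarith)
    rw [← hp, hpt, map_zero, norm_zero, mul_zero] at this
    exact absurd (hyN N) (not_lt.2 this)
  refine ⟨boostedPath η X p,
    fun t => boostedRate T η X p t + mu T t • matrixAction (A t) (boostedRate T η X p t),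
    fun t ht => hasDeltaDerivAt_boostedPath hT hX hpc ht, fun t ht => ?_, ?_, fun t ht => ?_, ?_⟩
  · exact smul_ne_zero (Real.exp_pos _).ne' (hinj t ht _ (hpne t ht))
  · have hr := rdContinuous_boostedRate (η := η) hT hX hpc
    exact RdContinuous.comp₂ (φ := fun a b : EuclideanSpace 𝕜 (Fin n) => a + b) continuous_add hr
      (RdContinuous.comp₂ (φ := fun (c : ℝ) (v : EuclideanSpace 𝕜 (Fin n)) => c • v)
        continuous_smul hT.rdContinuous_mu
        (RdContinuous.comp₂ (φ := fun B v => matrixAction B v) continuous_matrixAction hA hr))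
  · obtain ⟨N, h1, h2⟩ := exists_block hLpos (h0 ht)
    have hslope := hX.norm_dslope_stepPath_le hT hM0.le hL hM hK.le hε0.le hε1 hD0.le hD (hz N).1
      ht h1 h2
    have hrate := norm_boostedRate_le hT hη0.le hM0 (hM t ht) hslope
    refine (norm_add_mu_smul_action_le hT (hM t ht) (hAK t ht) _).trans ?_
    have hexp : Real.exp (η * M) ≤ Real.exp M := by
      rw [Real.exp_le_exp]
      nlinarith
    calc _ ≤ (1 + M * K) * (Real.exp (η * M) * (η + 2 * D * ε * Real.exp (2 * (K * (M + 1)))) *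
          ‖boostedPath η X p t‖) := by gcongr
      _ ≤ (1 + M * K) * (Real.exp M * (η + 2 * D * ε * Real.exp (2 * (K * (M + 1)))) *
          ‖boostedPath η X p t‖) := by gcongr
      _ = (c₀ * η + c₀ * (c₁ * ε)) * ‖boostedPath η X p t‖ := by
          rw [hc₀, hc₁]
          ring
      _ ≤ δ * ‖boostedPath η X p t‖ := by
          gcongr
          linarith
  · intro C b
    -- Of the rate `η`, one third pays for the displacements, one third for the possible decay of
    -- the staircase, and one third remains. `c₂` collects the bounded errors, including `η / 3 * L`
    -- for passing from `t` to `N L`; `W` is the threshold past which the remaining third exceeds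
    -- `|C| / y₀ + c₂`.
    set a : ℕ → ℝ := fun j => Real.log ‖nodeTransition T L X Y j‖ with ha
    set y₀ := ‖matrixAction (X (node T L 0)) (z 0)‖ with hy₀
    set c₂ := K * (L + M) + |stepSum L M a 0| + η / 3 * L with hc₂
    set W := (|C| / y₀ + c₂) * (3 / η) with hW
    -- The added `L` ensures that the start `N L` of the block containing `t` is still beyond `b`
    -- and `W`.
    obtain ⟨t, ht, hbt, hlt⟩ := hfreq L hL (η / 3) (by positivity) (max b W + L)
    obtain ⟨N, h1, h2⟩ := exists_block hLpos (h0 ht)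
    have hNL : max b W ≤ N * L := by linarith
    have hNb : b ≤ N * L := (le_max_left _ _).trans hNL
    have hNW : W ≤ N * L := (le_max_right _ _).trans hNL
    refine ⟨node T L N, hT.node_mem L N, hNb.trans (hT.le_node L N), ?_⟩
    have hn1 := hT.le_node L N
    have hn2 := hT.node_le hLpos.le hM N
    have hpn : p (node T L N) = z N := by
      rw [hp, stepPath_block hM0.le hL z (by linarith : N * L - 1 ≤ node T L N) (by linarith),
        Real.smoothTransition.zero_of_nonpos (by linarith), zero_smul, add_zero]
    have hsum := (abs_le.1 (abs_stepSum_sub_le hM0.le hL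
      (hX.abs_log_nodeTransition_le hT hLpos.le hM hK.le) h1 h2.le)).2
    have hS : -(η / 3 * (N * L)) - c₂ ≤ ∑ j ∈ Finset.range N, a j := by
      have h5 := neg_abs_le (stepSum L M a 0)
      have h6 : η / 3 * t ≤ η / 3 * (N * L) + η / 3 * L := by nlinarith
      rw [hc₂]
      linarith
    have hexpo : |C| / y₀ ≤
        η * node T L N + (∑ j ∈ Finset.range N, a j - N * Real.log (2 / ε)) := by
      have h7 : η * (N * L) ≤ η * node T L N := by gcongr
      have h8 : (N : ℝ) * Real.log (2 / ε) ≤ η / 3 * (N * L) := by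
        have : (N : ℝ) * (3 * Real.log (2 / ε)) ≤ N * (η * L) := by gcongr
        linarith
      have h9 : |C| / y₀ + c₂ ≤ η / 3 * (N * L) := by
        have := mul_le_mul_of_nonneg_left hNW (by positivity : 0 ≤ η / 3)
        refine le_trans (le_of_eq ?_) this
        rw [hW]
        field_simp
      linarith
    rw [boostedPath, hpn, norm_smul, Real.norm_of_nonneg (Real.exp_pos _).le]
    calc C ≤ |C| / y₀ * y₀ := by
          rw [div_mul_cancel₀ _ hy0.ne']
          exact le_abs_self C
      _ < Real.exp (|C| / y₀) * y₀ := by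
          refine mul_lt_mul_of_pos_right ?_ hy0
          linarith [Real.add_one_le_exp (|C| / y₀)]
      _ ≤ Real.exp (η * node T L N + (∑ j ∈ Finset.range N, a j - N * Real.log (2 / ε))) * y₀ := by
          gcongr
      _ ≤ _ := by
          rw [Real.exp_add, mul_assoc]
          exact mul_le_mul_of_nonneg_left (hgrow N) (Real.exp_pos _).le

end GrowingSolution

end TimeScale

/-! ### Assembly of the destabilizing perturbation -/

theorem theorem6p1 {𝕜 : Type*} [RCLike 𝕜] {n : ℕ} (T : Set ℝ)
    (hT : TimeScale.IsTimeScale T) (hsyn : TimeScale.IsSyndetic T)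
    (A : ℝ → Matrix (Fin n) (Fin n) 𝕜)
    (hrd : TimeScale.RdContinuous T A) (hbdd : TimeScale.IsBounded T A)
    (hreg : TimeScale.IsUniformlyRegressive T A)
    (hχ : 0 ≤ TimeScale.centralUpperExponent T A) :
    ∀ δ : ℝ, 0 < δ → ∃ B : ℝ → Matrix (Fin n) (Fin n) 𝕜,
      TimeScale.RdContinuous T B ∧
      (∀ t ∈ T, ‖B t‖ ≤ δ) ∧
      TimeScale.IsUniformlyRegressive T (A + B) ∧
      ¬ TimeScale.IsStable T (A + B) := by
  open TimeScale in
  intro δ hδ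
  have hT' := hT.inter_Ici_zero
  have h0 : T ∩ Set.Ici 0 ⊆ Set.Ici (0 : ℝ) := Set.inter_subset_right
  have hrd' := hrd.inter_Ici 0
  have hbdd' : IsBounded (T ∩ Set.Ici 0) A := hbdd.imp fun K hK t ht => hK t ht.1
  obtain ⟨hunit, K₂, hK₂⟩ := hreg
  have hreg' : IsUniformlyRegressive (T ∩ Set.Ici 0) A := by
    refine ⟨fun t ht => ?_, K₂, fun t ht => ?_⟩
    · rw [mu_inter_Ici T ht.2]
      exact hunit t ht.1
    · rw [mu_inter_Ici T ht.2]
      exact hK₂ t ht.1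
  obtain ⟨X, Y, K, hK, hAK, hX⟩ := exists_isFundamentalPair hT' h0 hrd' hbdd' hreg'
  have hn : NeZero n := ⟨pos_of_centralUpperExponent_nonneg hT hX hχ⟩
  obtain ⟨M, hM0, hM⟩ := hT.exists_mu_le hsyn
  have hM' : ∀ t ∈ T ∩ Set.Ici 0, mu (T ∩ Set.Ici 0) t ≤ M := fun t ht => by
    rw [mu_inter_Ici T ht.2]
    exact hM t ht.1 ht.2
  have hfreq : ∀ L, M + 2 ≤ L → ∀ κ > 0, ∀ b : ℝ, ∃ t ∈ T ∩ Set.Ici 0, b ≤ t ∧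
      -κ * t < stepSum L M (fun j => Real.log ‖nodeTransition (T ∩ Set.Ici 0) L X Y j‖) t
        - stepSum L M (fun j => Real.log ‖nodeTransition (T ∩ Set.Ici 0) L X Y j‖) 0 := by
    intro L hL κ hκ b
    have hG := contDiff_stepSum hM0.le (by linarith : 0 < L)
      (fun j => Real.log ‖nodeTransition (T ∩ Set.Ici 0) L X Y j‖)
    obtain ⟨t, ht, hbt, hpos, hlt⟩ := exists_lt_of_centralUpperExponent_nonneg hT hχ hG
      (isUpperFunction_expRate hT hX hG (Real.exp_pos _) fun s hs t ht hst =>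
        hX.norm_le_exp_stepSum hT' h0 hM0.le hL hM' hK.le hs ht hst) hκ b
    exact ⟨t, ⟨ht, hpos.le⟩, hbt, hlt⟩
  have hK₂0 : 0 ≤ K₂ := (norm_nonneg _).trans (hK₂ 0 hT.zero_mem)
  -- Shrinking `δ` preserves uniform regressivity: it makes the relative perturbation of `1 + μ A`
  -- at most `1 / 2`. The `+ 1` guards against `K₂ = 0`.
  obtain ⟨δ', hδ'0, hδ'δ, hsmall⟩ : ∃ δ' : ℝ, 0 < δ' ∧ δ' ≤ δ ∧ K₂ * (M * δ') ≤ 1 / 2 := by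
    refine ⟨min δ (1 / (2 * (K₂ * M + 1))), by positivity, min_le_left _ _, ?_⟩
    calc _ ≤ K₂ * (M * (1 / (2 * (K₂ * M + 1)))) := by gcongr; exact min_le_right _ _
      _ = K₂ * M / (K₂ * M + 1) * (1 / 2) := by field_simp
      _ ≤ 1 * (1 / 2) := by
        gcongr
        rw [div_le_one (by positivity)]
        linarith
      _ = 1 / 2 := one_mul _
  obtain ⟨x, g, hx, hx0, hg, hgx, hub⟩ :=
    exists_unbounded_perturbed_solution hT' h0 hM0 hM' hK hAK hrd' hX hfreq hδ'0
  obtain ⟨B, hBrd, hBle, hBneg, hBst⟩ := exists_destabilizing_perturbation hT hx hx0 hg hgx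
    (fun C b => by
      obtain ⟨t, ht, h⟩ := hub C b
      exact ⟨t, ht.1, h⟩)
  exact ⟨B, hBrd, fun t ht => (hBle t ht).trans hδ'δ,
    IsUniformlyRegressive.add_small hT hunit hK₂ hM hBle hBneg hsmall, hBst⟩
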